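/- Let $q\ge 1$ and let $\mathcal H=\bigoplus_{k=0}^q L^2(\mathbb R^q;\Lambda^k(\mathbb R^q)^*\otimes\mathbb C)$ be the Hilbert space of square integrable (complex-valued) differential forms on $\mathbb R^q$. Let $d$ be the exterior derivative on $\mathcal H$ (the closure of the exterior derivative on smooth compactly supported forms), $d^*$ its adjoint, $D=d+d^*$ the (self-adjoint) Dirac operator and $L=d^*d+dd^*$ the Hodge Laplacian. For $n\ge1$ let $\varphi_n$ be the unique $C^2$ solution on $\mathbb R$ of $$\varphi''(r)+(n-1)\frac{\varphi'(r)}{r}+\varphi(r)=0\quad(r\ne0),\qquad \varphi(0)=1,\quad \varphi'(0)=0,$$ and let $\varphi_n(tD)$, $t\in\mathbb R$, be the bounded operator on $\mathcal H$ given by the functional calculus of $D$. For $t\in\mathbb R$ put $d_t=t\,\varphi_{q+2}(tD)\,d$ on the domain of $d$. Let $f\in\mathcal H$ be in the domain of $d$ with $df$ in the domain of $L$ (for instance, $f$ smooth with compact support). Derivatives in $t$ are taken in the norm of $\mathcal H$. (a) The curve $u(t)=d_tf$ is twice differentiable and has values in the domain of $L$ for $t>0$, where it solves $$u_{tt}+(q-1)\Big[\frac{u_t}{t}-\frac{u}{t^2}\Big]+Lu=0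 .$$ Moreover $u(0)=0$, $u$ is differentiable at $0$ with $u_t(0)=df$, and $\lim_{t\to0}u_t(t)=df$. (b) The curve $u(t)=\varphi_q(tD)\,df$ is twice differentiable and has values in the domain of $L$ for $t>0$, where it solves $$u_{tt}+(q-1)\frac{u_t}{t}+Lu=0 .$$ Moreover $u(0)=df$, $u$ is differentiable at $0$ with $u_t(0)=0$, and $\lim_{t\to0}u_t(t)=0$. -/

import Mathlib

open MeasureTheory Filter Topology
open scoped InnerProductSpace LinearPMap

noncomputable section

/-! ### Spectral measures and the functional calculus of a self-adjoint operator -/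

section Spectral

variable {H : Type*} [NormedAddCommGroup H] [InnerProductSpace ℂ H] [CompleteSpace H]

/-- A projection-valued measure on the Borel sets of `ℝ`, acting on the Hilbert space `H`. -/
structure PVM (H : Type*) [NormedAddCommGroup H] [InnerProductSpace ℂ H] [CompleteSpace H] where
  /-- the projection attached to a set (only the values on Borel sets matter) -/
  proj : Set ℝ → H →L[ℂ] H
  isStarProjection : ∀ B, MeasurableSet B → IsStarProjection (proj B)
  proj_univ : proj Set.univ = 1
  proj_empty : proj ∅ = 0
  proj_inter : ∀ A B, MeasurableSet A → MeasurableSet B → proj (A ∩ B) = proj A * proj B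
  hasSum_proj : ∀ A : ℕ → Set ℝ, (∀ n, MeasurableSet (A n)) → Pairwise (Function.onFun Disjoint A) →
    ∀ x, HasSum (fun n => proj (A n) x) (proj (⋃ n, A n) x)

theorem PVM.norm_sq_eq (E : PVM H) (x : H) {B : Set ℝ} (hB : MeasurableSet B) :
    ‖E.proj B x‖ ^ 2 = (⟪x, E.proj B x⟫_ℂ).re := by
  have h := E.isStarProjection B hB
  have h1 : E.proj B (E.proj B x) = E.proj B x := by
    have := congrArg (fun T : H →L[ℂ] H => T x) h.isIdempotentElem
    simpa using this
  have h2 : ⟪E.proj B x, E.proj B x⟫_ℂ = ⟪x, E.proj B (E.proj B x)⟫_ℂ := by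
    rw [← ContinuousLinearMap.adjoint_inner_right, ← ContinuousLinearMap.star_eq_adjoint,
      h.isSelfAdjoint.star_eq]
  rw [← h1, ← h2, h1]
  simpa using (norm_sq_eq_re_inner (𝕜 := ℂ) (E.proj B x))

/-- The scalar spectral measure `B ↦ ⟪x, E(B) x⟫ = ‖E(B) x‖²` of a vector `x`. -/
def PVM.scalar (E : PVM H) (x : H) : Measure ℝ :=
  Measure.ofMeasurable (fun B _ => ENNReal.ofReal (‖E.proj B x‖ ^ 2))
    (by simp [E.proj_empty])
    (by
      intro A hA hd
      have h : HasSum (fun n => ‖E.proj (A n) x‖ ^ 2) (‖E.proj (⋃ n, A n) x‖ ^ 2) := by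
        simp only [E.norm_sq_eq x (hA _), E.norm_sq_eq x (MeasurableSet.iUnion hA)]
        exact Complex.hasSum_re ((E.hasSum_proj A hA hd x).mapL (innerSL ℂ x))
      rw [← h.tsum_eq, ENNReal.ofReal_tsum_of_nonneg (fun n => by positivity) h.summable])

/-- `A = ∫ s dE(s)`: the domain of `A` consists of the `x` with `∫ s² d⟪x, E x⟫ < ∞`, and
`⟪x, A x⟫ = ∫ s d⟪x, E x⟫` there (which determines `A` by polarization). -/
def PVM.IsResolutionOf (E : PVM H) (A : H →ₗ.[ℂ] H) : Prop :=
  (∀ x, x ∈ A.domain ↔ Integrable (fun s : ℝ => s ^ 2) (E.scalar x)) ∧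
    ∀ x : A.domain, ⟪(x : H), A x⟫_ℂ = ((∫ s, s ∂(E.scalar x) : ℝ) : ℂ)

open Classical in
/-- `∫ g(s) dE(s)` for a bounded Borel function `g`: the bounded operator `T`
with `⟪x, T x⟫ = ∫ g d⟪x, E x⟫` for all `x` (it exists, and is unique by polarization). -/
def PVM.integral (E : PVM H) (g : ℝ → ℝ) : H →L[ℂ] H :=
  if h : ∃ T : H →L[ℂ] H, ∀ x, ⟪x, T x⟫_ℂ = ((∫ s, g s ∂(E.scalar x) : ℝ) : ℂ) then h.choose
  else 0

open Classical in
/-- The functional calculus `g(A) = ∫ g(s) dE(s)` of a self-adjoint operator `A`, for bounded Borel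
functions `g`. By the spectral theorem, `E` exists and is unique if `A` is self-adjoint. -/
def funCalc (A : H →ₗ.[ℂ] H) (g : ℝ → ℝ) : H →L[ℂ] H :=
  if h : ∃ E : PVM H, E.IsResolutionOf A then h.choose.integral g else 0

/-- The product `B A` of two unbounded operators, with its natural domain
`{x ∈ dom A | A x ∈ dom B}`. -/
def opMul (B A : H →ₗ.[ℂ] H) : H →ₗ.[ℂ] H :=
  B.comp (A.domRestrict ((B.domain.comap A.toFun).map A.domain.subtype)) (by
    rintro ⟨x, ⟨y, hy, rfl⟩, hx⟩
    exact hy)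

end Spectral

/-! ### Bessel functions -/

/-- `f'' + (n-1) f'/r + f = 0`, `f(0) = 1`, `f'(0) = 0`, with `f` of class `C²` on the line. -/
structure IsBesselSolution (n : ℕ) (f : ℝ → ℝ) : Prop where
  contDiff : ContDiff ℝ 2 f
  ode : ∀ r : ℝ, r ≠ 0 → deriv (deriv f) r + ((n : ℝ) - 1) * (deriv f r / r) + f r = 0
  init : f 0 = 1
  init_deriv : deriv f 0 = 0

open Classical in
/-- `φ_n`, the unique solution of the initial value problem `IsBesselSolution n` (for `n ≥ 1`). -/
def besselPhi (n : ℕ) : ℝ → ℝ :=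
  if h : ∃ f, IsBesselSolution n f then h.choose else 0

/-! ### Differential forms on `ℝ^q` -/

section Forms

/-- Euclidean space `ℝ^q`. -/
abbrev Rn (q : ℕ) : Type := EuclideanSpace ℝ (Fin q)

/-- Complex-valued alternating `k`-linear forms on `ℝ^q`. -/
abbrev AltForm (q k : ℕ) : Type := Rn q [⋀^Fin k]→L[ℝ] ℂ

/-- The fibre `⊕_k Λ^k (ℝ^q)* ⊗ ℂ`, in the orthonormal basis
`dx_I = dx_{i_1} ∧ ... ∧ dx_{i_k}`, `I = {i_1 < ... < i_k} ⊆ {1, ..., q}`. -/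
abbrev FormFibre (q : ℕ) : Type := EuclideanSpace ℂ (Finset (Fin q))

/-- The Hilbert space of square integrable differential forms of all degrees on `ℝ^q`. -/
abbrev FormSpace (q : ℕ) : Type := Lp (FormFibre q) 2 (volume : Measure (Rn q))

/-- The coordinates `α(e_{i_1}, ..., e_{i_k})`, `I = {i_1 < ... < i_k}`, of a `k`-form `α`
in the basis `dx_I` (the coordinates with `|I| ≠ k` are `0`). -/
def formCoeff {q k : ℕ} (α : AltForm q k) : FormFibre q :=
  WithLp.toLp 2 fun I =>
    if h : I.card = k then α fun i => EuclideanSpace.single (I.orderEmbOfFin h i) (1 : ℝ) else 0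

/-- The graph of the exterior derivative on the smooth compactly supported forms: the span of
the pairs `(ω, dω)`, where `ω` is a smooth compactly supported `k`-form for some `k`. -/
def testGraph (q : ℕ) : Submodule ℂ (FormSpace q × FormSpace q) :=
  Submodule.span ℂ {p | ∃ (k : ℕ) (ω : Rn q → AltForm q k),
    ContDiff ℝ (⊤ : ℕ∞) ω ∧ HasCompactSupport ω ∧
    (p.1 : Rn q → FormFibre q) =ᵐ[volume] (fun x => formCoeff (ω x)) ∧
    (p.2 : Rn q → FormFibre q) =ᵐ[volume] (fun x => formCoeff (extDeriv ω x))}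

/-- The exterior derivative `d` as a closed unbounded operator on the Hilbert space of forms: the
closure of its restriction to the smooth compactly supported forms. -/
def extD (q : ℕ) : FormSpace q →ₗ.[ℂ] FormSpace q :=
  (testGraph q).topologicalClosure.toLinearPMap

/-- The Dirac operator `D = d + d*`. -/
def dirac (q : ℕ) : FormSpace q →ₗ.[ℂ] FormSpace q :=
  extD q + (extD q)†

/-- The Hodge Laplacian `L = d* d + d d*`. -/
def hodgeLaplacian (q : ℕ) : FormSpace q →ₗ.[ℂ] FormSpace q :=
  opMul (extD q)† (extD q) + opMul (extD q) (extD q)†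

/-- `φ_n(t D)`. -/
def phiDirac (q n : ℕ) (t : ℝ) : FormSpace q →L[ℂ] FormSpace q :=
  funCalc (dirac q) fun s => besselPhi n (t * s)

/-- The deformed exterior derivative `d_t = t φ_{q+2}(t D) d`, on the domain of `d`. -/
def deformedExtD (q : ℕ) (t : ℝ) : FormSpace q →ₗ.[ℂ] FormSpace q :=
  (t • phiDirac q (q + 2) t).toLinearMap.compPMap (extD q)

/-- The Bessel acceleration `D_tt u = u_tt + (q-1) (u_t / t - u / t²)`. -/
def besselAccelOne (q : ℕ) (u : ℝ → FormSpace q) (t : ℝ) : FormSpace q :=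
  deriv (deriv u) t + ((q : ℝ) - 1) • ((1 / t) • deriv u t - (1 / t ^ 2) • u t)

/-- The Bessel acceleration `d_tt u = u_tt + (q-1) u_t / t`. -/
def besselAccelZero (q : ℕ) (u : ℝ → FormSpace q) (t : ℝ) : FormSpace q :=
  deriv (deriv u) t + ((q : ℝ) - 1) • ((1 / t) • deriv u t)

/-- `u` solves `a(u) + L u = 0` for `t > 0`, where `a` is a second order acceleration: at every
`t > 0` the curve `u` is twice differentiable in the Hilbert space of forms, `u(t)` lies in the
domain of `L`, and the equation holds. -/
def SolvesWave (q : ℕ) (a : (ℝ → FormSpace q) → ℝ → FormSpace q) (u : ℝ → FormSpace q) : Prop :=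
  ∀ t : ℝ, 0 < t → DifferentiableAt ℝ u t ∧ DifferentiableAt ℝ (deriv u) t ∧
    ∃ h : u t ∈ (hodgeLaplacian q).domain, a u t + hodgeLaplacian q ⟨u t, h⟩ = 0

end Forms

end

noncomputable section

/-! ### Isometric extension of a representation by bounded functions -/

/-! Since d² = 0, the cross terms of D² vanish and L = D², domains included
(`mem_graph_laplacian_iff`). Hence v = df lies in the domain of D². If E is the spectral measure of
D, then w(t) = φ_n(tD)v = ∫ φ_n(ts) dE(s)v. The energy φ² + φ'² is largest at 0, so φ_n and φ_n' are
bounded by 1 and φ_n'' is bounded as well. The t-derivatives sφ_n'(ts) and s²φ_n''(ts) are therefore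
dominated by multiples of |s| and s², which are square integrable for the spectral measure of v.
Dominated convergence permits two differentiations, and the Bessel equation at r = ts becomes t w''
+ (n-1)w' + tLw = 0 (`bessel_curve`). For n = q, division by t gives (b). For n = q+2 and u = tw,
the Bessel acceleration of u is t w'' + (q+1)w', which gives (a).

The operators and functions are defined by choice or with default values, so most of the work is to
show that they exist: `exists_isResolutionOf` for E, `isBesselSolution_besselSeries` for φ_n,
`closure_testGraph_functional` for d. Uniqueness is not needed, because only defining properties of
the chosen objects are used.

The structure `SpectralRep` serves twice: for continuous functions on the spectrum of the resolvent,
where it yields E, and for step functions of E, where it yields the calculus of unbounded functions.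
In both cases the identity ‖a(A)x‖ = ‖a‖ in L² of the spectral measure of x extends a ↦ a(A)x
isometrically to all of L². -/

theorem eLpNorm_two_sq {X : Type*} [MeasurableSpace X] {F : Type*} [NormedAddCommGroup F]
    (f : X → F) (μ : Measure X) : eLpNorm f 2 μ ^ 2 = ∫⁻ s, ‖f s‖ₑ ^ 2 ∂μ := by
  have := eLpNorm_nnreal_pow_eq_lintegral (f := f) (μ := μ) (p := 2) (by norm_num)
  simpa using this

/-- Multiplication by `h` is an isometry from L²(|h|²μ) to L²(μ); this underlies the
multiplicativity of the calculus in `vec_vec`. -/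
theorem eLpNorm_two_withDensity {X : Type*} [MeasurableSpace X] (μ : Measure X) {g h : X → ℂ}
    (hg : Measurable g) (hh : Measurable h) :
    eLpNorm g 2 (μ.withDensity fun s => ‖h s‖ₑ ^ 2) = eLpNorm (g * h) 2 μ := by
  have h2 : eLpNorm g 2 (μ.withDensity fun s => ‖h s‖ₑ ^ 2) ^ 2 = eLpNorm (g * h) 2 μ ^ 2 := by
    rw [eLpNorm_two_sq, eLpNorm_two_sq, lintegral_withDensity_eq_lintegral_mul₀
      (hh.enorm.pow_const 2).aemeasurable (hg.enorm.pow_const 2).aemeasurable]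
    refine lintegral_congr fun s => ?_
    simp only [Pi.mul_apply, enorm_mul]
    ring
  exact (ENNReal.pow_right_strictMono two_ne_zero).injective h2

theorem MeasureTheory.MemLp.add_measure_two {X : Type*} [MeasurableSpace X] {μ ν : Measure X}
    {g : X → ℂ} (hμ : MemLp g 2 μ) (hν : MemLp g 2 ν) : MemLp g 2 (μ + ν) := by
  refine ⟨hμ.1.add_measure hν.1, ?_⟩
  have h : eLpNorm g 2 (μ + ν) ^ 2 < ⊤ := by
    rw [eLpNorm_two_sq, lintegral_add_measure, ← eLpNorm_two_sq, ← eLpNorm_two_sq]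
    exact ENNReal.add_lt_top.2 ⟨ENNReal.pow_lt_top hμ.2, ENNReal.pow_lt_top hν.2⟩
  exact (ENNReal.pow_lt_top_iff.1 h).resolve_right two_ne_zero

/-- A representation `op` of an algebra of bounded measurable functions on `X` by bounded operators
on `H`, together with finite measures `meas x` such that `‖op a x‖` is the norm of the function
of `a` in `L²(meas x)`. The functions are assumed to be dense in all `L²`-spaces of finite
measures. -/
structure SpectralRep (𝒜 X H : Type*) [AddCommGroup 𝒜] [Module ℂ 𝒜] [MeasurableSpace X]
    [NormedAddCommGroup H] [InnerProductSpace ℂ H] where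
  /-- the function attached to an element of the algebra -/
  ev : 𝒜 →ₗ[ℂ] (X → ℂ)
  /-- the operator attached to an element of the algebra -/
  op : 𝒜 →ₗ[ℂ] (H →L[ℂ] H)
  /-- the spectral measure of a vector -/
  meas : H → Measure X
  finite_meas : ∀ x, IsFiniteMeasure (meas x)
  measurable_ev : ∀ a, Measurable (ev a)
  bounded_ev : ∀ a, ∃ C : ℝ, ∀ s, ‖ev a s‖ ≤ C
  norm_op_sq : ∀ a x, ‖op a x‖ ^ 2 = ∫ s, ‖ev a s‖ ^ 2 ∂(meas x)
  exists_mul : ∀ a b, ∃ c, ev c = ev a * ev b ∧ op c = op a * op b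
  exists_one : ∃ e, ev e = 1 ∧ op e = 1
  exists_approx : ∀ (ν : Measure X) [IsFiniteMeasure ν] (g : X → ℂ), MemLp g 2 ν →
    ∀ ε : ENNReal, ε ≠ 0 → ∃ a, eLpNorm (g - ev a) 2 ν ≤ ε

namespace SpectralRep

variable {𝒜 X H : Type*} [AddCommGroup 𝒜] [Module ℂ 𝒜] [MeasurableSpace X]
  [NormedAddCommGroup H] [InnerProductSpace ℂ H] (S : SpectralRep 𝒜 X H)

instance (x : H) : IsFiniteMeasure (S.meas x) := S.finite_meas x

theorem memLp_ev (a : 𝒜) (ν : Measure X) [IsFiniteMeasure ν] : MemLp (S.ev a) 2 ν := by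
  obtain ⟨C, hC⟩ := S.bounded_ev a
  exact MemLp.of_bound (S.measurable_ev a).aestronglyMeasurable C (.of_forall hC)

theorem enorm_op (a : 𝒜) (x : H) : ‖S.op a x‖ₑ = eLpNorm (S.ev a) 2 (S.meas x) := by
  refine (ENNReal.pow_right_strictMono two_ne_zero).injective ?_
  rw [eLpNorm_two_sq, ← ofReal_norm, ← ENNReal.ofReal_pow (norm_nonneg _), S.norm_op_sq,
    ofReal_integral_eq_lintegral_ofReal]
  · refine lintegral_congr fun s => ?_
    rw [← ofReal_norm, ENNReal.ofReal_pow (norm_nonneg _)]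
  · exact (S.memLp_ev a _).integrable_norm_pow two_ne_zero
  · exact .of_forall fun s => by positivity

theorem exists_seq (ν : Measure X) [IsFiniteMeasure ν] {g : X → ℂ} (hg : MemLp g 2 ν) :
    ∃ a : ℕ → 𝒜, Tendsto (fun n => eLpNorm (S.ev (a n) - g) 2 ν) atTop (𝓝 0) := by
  have h : ∀ n : ℕ, ∃ a, eLpNorm (g - S.ev a) 2 ν ≤ ((n : ENNReal) + 1)⁻¹ := fun n =>
    S.exists_approx ν g hg _ (by simp)
  choose a ha using h
  refine ⟨a, tendsto_of_tendsto_of_tendsto_of_le_of_le tendsto_const_nhds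
    (h := fun n : ℕ => ((n : ENNReal) + 1)⁻¹) ?_ (fun _ => zero_le) fun n => ?_⟩
  · have := (tendsto_add_atTop_iff_nat 1).2 ENNReal.tendsto_inv_nat_nhds_zero
    simpa using this
  · rw [eLpNorm_sub_comm]
    exact ha n

/-- Convergence in `L²(ν)` implies convergence in `L²(ν')` for `ν' ≤ ν`. -/
theorem _root_.tendsto_eLpNorm_mono_measure {ν ν' : Measure X} (h : ν' ≤ ν) {f : ℕ → X → ℂ}
    (hf : Tendsto (fun n => eLpNorm (f n) 2 ν) atTop (𝓝 0)) :
    Tendsto (fun n => eLpNorm (f n) 2 ν') atTop (𝓝 0) :=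
  tendsto_of_tendsto_of_tendsto_of_le_of_le tendsto_const_nhds hf (fun _ => zero_le)
    fun n => eLpNorm_mono_measure (f n) h

/-- The element of `L²(meas x)` defined by an element of the algebra. -/
def toL2 (x : H) : 𝒜 →ₗ[ℂ] Lp ℂ 2 (S.meas x) where
  toFun a := (S.memLp_ev a _).toLp
  map_add' a b := by
    rw [← MemLp.toLp_add]
    exact MemLp.toLp_congr _ _ (by rw [map_add])
  map_smul' c a := by
    rw [RingHom.id_apply, ← MemLp.toLp_const_smul]
    exact MemLp.toLp_congr _ _ (by rw [map_smul])

theorem denseRange_toL2 (x : H) : DenseRange (S.toL2 x) := by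
  intro g
  rw [Metric.mem_closure_range_iff]
  intro ε hε
  obtain ⟨a, ha⟩ := S.exists_approx (S.meas x) g (Lp.memLp g) (ENNReal.ofReal (ε / 2))
    (by simpa using hε)
  refine ⟨a, ?_⟩
  rw [← Lp.toLp_coeFn g (Lp.memLp g), ← ENNReal.ofReal_lt_ofReal_iff hε, ← edist_dist]
  refine lt_of_le_of_lt (b := ENNReal.ofReal (ε / 2)) ?_
    ((ENNReal.ofReal_lt_ofReal_iff hε).2 (by linarith))
  exact (Lp.edist_toLp_toLp _ _ (Lp.memLp g) (S.memLp_ev a _)).trans_le ha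

/-- The evaluation of the operators at a vector. -/
def opAt (x : H) : 𝒜 →ₗ[ℂ] H where
  toFun a := S.op a x
  map_add' a b := by simp
  map_smul' c a := by simp

theorem norm_opAt (x : H) (a : 𝒜) : ‖S.opAt x a‖ = ‖S.toL2 x a‖ := by
  have : ‖S.opAt x a‖ₑ = ‖S.toL2 x a‖ₑ := by
    change ‖S.op a x‖ₑ = ‖(S.memLp_ev a _).toLp‖ₑ
    rw [Lp.enorm_toLp, S.enorm_op]
  simpa using congrArg ENNReal.toReal this

variable {S}

theorem memLp_ev_mul {ν : Measure X} (a : 𝒜) {h : X → ℂ} (hh : MemLp h 2 ν) :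
    MemLp (S.ev a * h) 2 ν := by
  obtain ⟨C, hC⟩ := S.bounded_ev a
  refine MemLp.of_le_mul (c := C) hh
    ((S.measurable_ev a).aestronglyMeasurable.mul hh.1) (.of_forall fun s => ?_)
  simpa using mul_le_mul_of_nonneg_right (hC s) (norm_nonneg (h s))

theorem tendsto_eLpNorm_ev {ν : Measure X} [IsFiniteMeasure ν] {a : ℕ → 𝒜} {g : X → ℂ}
    (hg : MemLp g 2 ν) (h : Tendsto (fun n => eLpNorm (S.ev (a n) - g) 2 ν) atTop (𝓝 0)) :
    Tendsto (fun n => eLpNorm (S.ev (a n)) 2 ν) atTop (𝓝 (eLpNorm g 2 ν)) := by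
  have h1 : Tendsto (fun n => (S.memLp_ev (a n) ν).toLp) atTop (𝓝 hg.toLp) := by
    rw [tendsto_iff_edist_tendsto_0]
    simpa only [Lp.edist_toLp_toLp] using h
  have h2 := (continuous_enorm.tendsto _).comp h1
  simpa only [Function.comp_def, Lp.enorm_toLp] using h2

/-- Finite measures are determined by the `L²`-norms of the functions of the algebra. -/
theorem measure_ext {ν ν' : Measure X} [IsFiniteMeasure ν] [IsFiniteMeasure ν']
    (h : ∀ a, eLpNorm (S.ev a) 2 ν = eLpNorm (S.ev a) 2 ν') : ν = ν' := by
  ext B hB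
  have hm : ∀ (ρ : Measure X) [IsFiniteMeasure ρ], MemLp (B.indicator (1 : X → ℂ)) 2 ρ :=
    fun ρ _ => (memLp_const (1 : ℂ)).indicator hB
  -- Approximating in L² of the sum gives one sequence that converges for both measures.
  obtain ⟨a, ha⟩ := S.exists_seq (ν + ν') (hm _)
  have h1 := tendsto_eLpNorm_ev (hm ν) (tendsto_eLpNorm_mono_measure
    (Measure.le_add_right le_rfl) ha)
  have h2 := tendsto_eLpNorm_ev (hm ν') (tendsto_eLpNorm_mono_measure
    (Measure.le_add_left le_rfl) ha)
  simp only [h] at h1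
  have h3 := congrArg (· ^ 2) (tendsto_nhds_unique h1 h2)
  have h4 : ∀ s, ‖B.indicator (1 : X → ℂ) s‖ₑ ^ 2 = B.indicator 1 s := by
    intro s
    by_cases hs : s ∈ B <;> simp [hs]
  simpa [eLpNorm_two_sq, h4, lintegral_indicator_one hB] using h3

variable [CompleteSpace H]

variable (S) in
/-- The isometric extension of `a ↦ op a x` to `L²(meas x)`. -/
def iso (x : H) : Lp ℂ 2 (S.meas x) →ₗᵢ[ℂ] H where
  toLinearMap := ((S.opAt x).extendOfNorm (S.toL2 x)).toLinearMap
  norm_map' g := by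
    have hext : ∀ a, (S.opAt x).extendOfNorm (S.toL2 x) (S.toL2 x a) = S.opAt x a :=
      LinearMap.extendOfNorm_eq (S.denseRange_toL2 x)
        ⟨1, fun a => by rw [one_mul, S.norm_opAt]⟩
    refine (S.denseRange_toL2 x).induction_on (p := fun g =>
      ‖(S.opAt x).extendOfNorm (S.toL2 x) g‖ = ‖g‖) g ?_ fun a => ?_
    · exact isClosed_eq (by fun_prop) (by fun_prop)
    · rw [hext, S.norm_opAt]

variable (S) in
theorem iso_toL2 (x : H) (a : 𝒜) : S.iso x (S.toL2 x a) = S.op a x :=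
  LinearMap.extendOfNorm_eq (S.denseRange_toL2 x)
    ⟨1, fun a => by rw [one_mul, S.norm_opAt]⟩ a

variable (S) in
open Classical in
/-- The vector `g(A) x` for `g` in `L²(meas x)`. -/
def vec (x : H) (g : X → ℂ) : H :=
  if h : MemLp g 2 (S.meas x) then S.iso x h.toLp else 0

theorem vec_eq {x : H} {g : X → ℂ} (h : MemLp g 2 (S.meas x)) : S.vec x g = S.iso x h.toLp :=
  dif_pos h

theorem vec_ev (x : H) (a : 𝒜) : S.vec x (S.ev a) = S.op a x := by
  rw [vec_eq (S.memLp_ev a _)]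
  exact S.iso_toL2 x a

theorem vec_one (x : H) : S.vec x 1 = x := by
  obtain ⟨e, he, he'⟩ := S.exists_one
  rw [← he, vec_ev, he']
  simp

theorem enorm_vec {x : H} {g : X → ℂ} (h : MemLp g 2 (S.meas x)) :
    ‖S.vec x g‖ₑ = eLpNorm g 2 (S.meas x) := by
  rw [vec_eq h, ← Lp.enorm_toLp h]
  exact (S.iso x).enorm_map _

theorem vec_congr {x : H} {g h : X → ℂ} (e : g =ᵐ[S.meas x] h) : S.vec x g = S.vec x h := by
  by_cases hg : MemLp g 2 (S.meas x)
  · have hh := (memLp_congr_ae e).1 hg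
    rw [vec_eq hg, vec_eq hh, MemLp.toLp_congr hg hh e]
  · have hh : ¬ MemLp h 2 (S.meas x) := fun hh => hg ((memLp_congr_ae e).2 hh)
    rw [vec, vec, dif_neg hg, dif_neg hh]

theorem vec_add {x : H} {g h : X → ℂ} (hg : MemLp g 2 (S.meas x)) (hh : MemLp h 2 (S.meas x)) :
    S.vec x (g + h) = S.vec x g + S.vec x h := by
  rw [vec_eq hg, vec_eq hh, vec_eq (hg.add hh), MemLp.toLp_add, map_add]

theorem vec_sub {x : H} {g h : X → ℂ} (hg : MemLp g 2 (S.meas x)) (hh : MemLp h 2 (S.meas x)) :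
    S.vec x (g - h) = S.vec x g - S.vec x h := by
  rw [vec_eq hg, vec_eq hh, vec_eq (hg.sub hh), MemLp.toLp_sub, map_sub]

theorem vec_const_smul {x : H} {g : X → ℂ} (c : ℂ) (hg : MemLp g 2 (S.meas x)) :
    S.vec x (c • g) = c • S.vec x g := by
  rw [vec_eq hg, vec_eq (hg.const_smul c), MemLp.toLp_const_smul, map_smul]

theorem vec_zero (x : H) : S.vec x 0 = 0 := by
  rw [vec_eq MemLp.zero, MemLp.toLp_zero, map_zero]

theorem inner_vec {x : H} {g h : X → ℂ} (hg : MemLp g 2 (S.meas x)) (hh : MemLp h 2 (S.meas x)) :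
    ⟪S.vec x g, S.vec x h⟫_ℂ = ∫ s, (starRingEnd ℂ) (g s) * h s ∂(S.meas x) := by
  rw [vec_eq hg, vec_eq hh, LinearIsometry.inner_map_map, L2.inner_def]
  refine integral_congr_ae ?_
  filter_upwards [hg.coeFn_toLp, hh.coeFn_toLp] with s h1 h2
  rw [h1, h2, RCLike.inner_apply, mul_comm]

theorem inner_self_vec {x : H} {g : X → ℂ} (hg : MemLp g 2 (S.meas x)) :
    ⟪x, S.vec x g⟫_ℂ = ∫ s, g s ∂(S.meas x) := by
  have h1 : MemLp (1 : X → ℂ) 2 (S.meas x) := memLp_const 1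
  have := inner_vec h1 hg
  simpa [vec_one] using this

theorem tendsto_vec {ι : Type*} {l : Filter ι} {x : H} {g : ι → X → ℂ} {h : X → ℂ}
    (hg : ∀ n, MemLp (g n) 2 (S.meas x)) (hh : MemLp h 2 (S.meas x))
    (ht : Tendsto (fun n => eLpNorm (g n - h) 2 (S.meas x)) l (𝓝 0)) :
    Tendsto (fun n => S.vec x (g n)) l (𝓝 (S.vec x h)) := by
  rw [tendsto_iff_edist_tendsto_0]
  refine ht.congr fun n => ?_
  rw [edist_eq_enorm_sub, ← vec_sub (hg n) hh, enorm_vec ((hg n).sub hh)]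

theorem tendsto_op {x : H} {a : ℕ → 𝒜} {h : X → ℂ} (hh : MemLp h 2 (S.meas x))
    (ht : Tendsto (fun n => eLpNorm (S.ev (a n) - h) 2 (S.meas x)) atTop (𝓝 0)) :
    Tendsto (fun n => S.op (a n) x) atTop (𝓝 (S.vec x h)) := by
  simpa only [vec_ev] using tendsto_vec (fun n => S.memLp_ev (a n) (S.meas x)) hh ht

/-- For `h` in the algebra this is multiplicativity of `op`. Multiplication by the bounded function
`S.ev a` is continuous on L², so the identity passes to limits. -/
theorem op_vec {x : H} (a : 𝒜) {h : X → ℂ} (hh : MemLp h 2 (S.meas x)) :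
    S.op a (S.vec x h) = S.vec x (S.ev a * h) := by
  obtain ⟨b, hb⟩ := S.exists_seq (S.meas x) hh
  obtain ⟨C, hC⟩ := S.bounded_ev a
  have h1 : Tendsto (fun n => S.op a (S.op (b n) x)) atTop (𝓝 (S.op a (S.vec x h))) :=
    ((S.op a).continuous.tendsto _).comp (tendsto_op hh hb)
  refine tendsto_nhds_unique h1 ?_
  have h2 : ∀ n, S.op a (S.op (b n) x) = S.vec x (S.ev a * S.ev (b n)) := by
    intro n
    obtain ⟨c, hc, hc'⟩ := S.exists_mul a (b n)
    rw [← hc, vec_ev, hc']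
    rfl
  simp only [h2]
  refine tendsto_vec (fun n => memLp_ev_mul a (S.memLp_ev _ _)) (memLp_ev_mul a hh) ?_
  have h3 : Tendsto (fun n => ENNReal.ofReal C * eLpNorm (S.ev (b n) - h) 2 (S.meas x)) atTop
      (𝓝 0) := by
    simpa using ENNReal.Tendsto.const_mul hb (Or.inr ENNReal.ofReal_ne_top)
  refine tendsto_of_tendsto_of_tendsto_of_le_of_le tendsto_const_nhds h3 (fun _ => zero_le)
    fun n => ?_
  rw [← mul_sub]
  refine eLpNorm_le_mul_eLpNorm_of_ae_le_mul (.of_forall fun s => ?_) 2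
  simpa using mul_le_mul_of_nonneg_right (hC s) (norm_nonneg _)

/-- Both measures give `S.ev a` the L²-norm ‖op a (vec x h)‖, and these norms determine a finite
measure. -/
theorem meas_vec {x : H} {h : X → ℂ} (hm : Measurable h) (hh : MemLp h 2 (S.meas x)) :
    S.meas (S.vec x h) = (S.meas x).withDensity fun s => ‖h s‖ₑ ^ 2 := by
  have : IsFiniteMeasure ((S.meas x).withDensity fun s => ‖h s‖ₑ ^ 2) := by
    refine isFiniteMeasure_withDensity ?_
    rw [← eLpNorm_two_sq]
    exact ENNReal.pow_ne_top hh.2.ne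
  refine S.measure_ext fun a => ?_
  rw [← S.enorm_op, op_vec a hh, enorm_vec (memLp_ev_mul a hh),
    eLpNorm_two_withDensity _ (S.measurable_ev a) hm]

theorem memLp_vec_iff {x : H} {g h : X → ℂ} (hg : Measurable g) (hm : Measurable h)
    (hh : MemLp h 2 (S.meas x)) :
    MemLp g 2 (S.meas (S.vec x h)) ↔ MemLp (g * h) 2 (S.meas x) := by
  rw [meas_vec hm hh, MemLp, MemLp, eLpNorm_two_withDensity _ hg hm]
  exact ⟨fun H => ⟨(hg.mul hm).aestronglyMeasurable, H.2⟩, fun H => ⟨hg.aestronglyMeasurable, H.2⟩⟩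

/-- By the density formula of `meas_vec`, approximating `g` in L² of the measure of `vec x h`
amounts to approximating `g * h` in L² of the measure of `x`. Thus `op_vec` extends to unbounded
`g`. -/
theorem vec_vec {x : H} {g h : X → ℂ} (hg : Measurable g) (hm : Measurable h)
    (hh : MemLp h 2 (S.meas x)) (hgh : MemLp (g * h) 2 (S.meas x)) :
    S.vec (S.vec x h) g = S.vec x (g * h) := by
  have hg' := (memLp_vec_iff hg hm hh).2 hgh
  obtain ⟨a, ha⟩ := S.exists_seq (S.meas (S.vec x h)) hg'
  have h1 := tendsto_op hg' ha
  refine tendsto_nhds_unique h1 ?_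
  simp only [op_vec _ hh]
  refine tendsto_vec (fun n => memLp_ev_mul _ hh) hgh (ha.congr fun n => ?_)
  rw [← sub_mul, meas_vec hm hh, eLpNorm_two_withDensity _ ((S.measurable_ev _).sub hg) hm]

/-- The three vectors live in different L²-spaces. A sequence approximating `g` in L² of the sum of
the three measures serves all of them, and each bounded `op` is additive. -/
theorem vec_add_left {x y : H} {g : X → ℂ} (hx : MemLp g 2 (S.meas x)) (hy : MemLp g 2 (S.meas y))
    (hxy : MemLp g 2 (S.meas (x + y))) : S.vec (x + y) g = S.vec x g + S.vec y g := by
  obtain ⟨a, ha⟩ := S.exists_seq (S.meas x + S.meas y + S.meas (x + y))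
    ((hx.add_measure_two hy).add_measure_two hxy)
  have h1 := tendsto_op hx (tendsto_eLpNorm_mono_measure
    (Measure.le_add_right (Measure.le_add_right le_rfl)) ha)
  have h2 := tendsto_op hy (tendsto_eLpNorm_mono_measure
    (Measure.le_add_right (Measure.le_add_left le_rfl)) ha)
  have h3 := tendsto_op hxy (tendsto_eLpNorm_mono_measure (Measure.le_add_left le_rfl) ha)
  refine tendsto_nhds_unique h3 ?_
  simpa only [map_add] using h1.add h2

/-- The vector `c • x` is the constant function `c` applied to `x`, so both claims are cases of
composition. -/
theorem vec_smul_left {x : H} {g : X → ℂ} (c : ℂ) (hg : Measurable g)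
    (hx : MemLp g 2 (S.meas x)) :
    MemLp g 2 (S.meas (c • x)) ∧ S.vec (c • x) g = c • S.vec x g := by
  have h1 : MemLp (c • (1 : X → ℂ)) 2 (S.meas x) := memLp_const (c • (1 : ℂ))
  have h2 : S.vec x (c • (1 : X → ℂ)) = c • x := by
    rw [vec_const_smul (g := 1) c (memLp_const (1 : ℂ)), vec_one]
  have hm : Measurable (c • (1 : X → ℂ)) := measurable_const (a := c • (1 : ℂ))
  have h3 : g * (c • (1 : X → ℂ)) = c • g := by
    ext s
    simp [mul_comm]
  have h4 : MemLp (g * (c • (1 : X → ℂ))) 2 (S.meas x) := by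
    rw [h3]
    exact hx.const_smul c
  rw [← h2]
  refine ⟨(memLp_vec_iff hg hm h1).2 h4, ?_⟩
  rw [vec_vec hg hm h1 h4, h3, vec_const_smul c hx]

theorem meas_univ (x : H) : S.meas x Set.univ = ‖x‖ₑ ^ 2 := by
  have h := enorm_vec (S := S) (x := x) (g := 1) (memLp_const 1)
  rw [vec_one] at h
  rw [h, eLpNorm_two_sq]
  simp

theorem _root_.memLp_of_bounded {g : X → ℂ} (hg : Measurable g) {C : ℝ} (hC : ∀ s, ‖g s‖ ≤ C)
    (ν : Measure X) [IsFiniteMeasure ν] : MemLp g 2 ν :=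
  MemLp.of_bound hg.aestronglyMeasurable C (.of_forall hC)

theorem norm_vec_le {g : X → ℂ} (hg : Measurable g) {C : ℝ} (hC : ∀ s, ‖g s‖ ≤ C) (x : H) :
    ‖S.vec x g‖ ≤ C * ‖x‖ := by
  have h1 : MemLp (1 : X → ℂ) 2 (S.meas x) := memLp_const 1
  have hg' := memLp_of_bounded hg hC (S.meas x)
  have h := eLpNorm_le_mul_eLpNorm_of_ae_le_mul (μ := S.meas x) (f := g) (g := (1 : X → ℂ))
    (c := C) (.of_forall fun s => by simpa using hC s) 2
  rw [← enorm_vec hg', ← enorm_vec h1, vec_one, ← ofReal_norm, ← ofReal_norm,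
    ← ENNReal.ofReal_mul' (norm_nonneg _)] at h
  -- A point of `X` is needed to know that `C` is nonnegative; if there is none, the total mass ‖x‖²
  -- is zero.
  rcases isEmpty_or_nonempty X with hX | ⟨⟨s⟩⟩
  · have hx : x = 0 := by
      have := meas_univ (S := S) x
      rw [Set.univ_eq_empty_iff.2 hX, measure_empty] at this
      simpa using this.symm
    have h0 : g = 0 := Subsingleton.elim _ _
    rw [h0, vec_zero, hx]
    simp
  · have hC0 : 0 ≤ C := (norm_nonneg _).trans (hC s)
    exact (ENNReal.ofReal_le_ofReal_iff (by positivity)).1 h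

/-- The bounded operator `g(A)`, for a bounded measurable function `g`. -/
def fn (S : SpectralRep 𝒜 X H) (g : X → ℂ) (hg : Measurable g) (hC : ∃ C, ∀ s, ‖g s‖ ≤ C) :
    H →L[ℂ] H :=
  LinearMap.mkContinuousOfExistsBound
    { toFun := fun x => S.vec x g
      map_add' := fun x y => by
        obtain ⟨C, hC⟩ := hC
        exact vec_add_left (memLp_of_bounded hg hC _) (memLp_of_bounded hg hC _)
          (memLp_of_bounded hg hC _)
      map_smul' := fun c x => by
        obtain ⟨C, hC⟩ := hC
        exact (vec_smul_left c hg (memLp_of_bounded hg hC _)).2 }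
    (by
      obtain ⟨C, hC⟩ := hC
      exact ⟨C, norm_vec_le hg hC⟩)

theorem fn_apply (g : X → ℂ) (hg : Measurable g) (hC : ∃ C, ∀ s, ‖g s‖ ≤ C) (x : H) :
    S.fn g hg hC x = S.vec x g := rfl

end SpectralRep

/-! ### Integration with respect to a projection-valued measure -/

section PVMIntegration

variable {H : Type*} [NormedAddCommGroup H] [InnerProductSpace ℂ H] [CompleteSpace H]

namespace PVM

variable (E : PVM H)

theorem scalar_apply (x : H) {B : Set ℝ} (hB : MeasurableSet B) :
    E.scalar x B = ENNReal.ofReal (‖E.proj B x‖ ^ 2) :=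
  Measure.ofMeasurable_apply B hB

instance (x : H) : IsFiniteMeasure (E.scalar x) :=
  ⟨by rw [E.scalar_apply x .univ]; exact ENNReal.ofReal_lt_top⟩

theorem inner_proj_proj (x : H) {A B : Set ℝ} (hA : MeasurableSet A) (hB : MeasurableSet B) :
    ⟪E.proj A x, E.proj B x⟫_ℂ = ((E.scalar x).real (A ∩ B) : ℂ) := by
  have h := E.isStarProjection A hA
  have hAB := E.isStarProjection _ (hA.inter hB)
  have key : ∀ (P : H →L[ℂ] H) (y z : H), IsSelfAdjoint P → ⟪P y, z⟫_ℂ = ⟪y, P z⟫_ℂ := by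
    intro P y z hP
    rw [← ContinuousLinearMap.adjoint_inner_right, ← ContinuousLinearMap.star_eq_adjoint,
      hP.star_eq]
  have h1 : ⟪E.proj A x, E.proj B x⟫_ℂ = ⟪x, E.proj (A ∩ B) x⟫_ℂ := by
    rw [key _ _ _ h.isSelfAdjoint, E.proj_inter A B hA hB]
    rfl
  have h2 : E.proj (A ∩ B) (E.proj (A ∩ B) x) = E.proj (A ∩ B) x := by
    have := congrArg (fun T : H →L[ℂ] H => T x) hAB.isIdempotentElem
    simpa using this
  rw [h1, ← h2, ← key _ _ _ hAB.isSelfAdjoint, measureReal_def, E.scalar_apply x (hA.inter hB),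
    ENNReal.toReal_ofReal (by positivity), inner_self_eq_norm_sq_to_K]
  simp

/-- Formal linear combinations of Borel sets. -/
abbrev SetComb : Type := {B : Set ℝ // MeasurableSet B} →₀ ℂ

/-- The step function of a formal linear combination of sets. -/
def stepFn : SetComb →ₗ[ℂ] (ℝ → ℂ) :=
  Finsupp.linearCombination ℂ fun B : {B : Set ℝ // MeasurableSet B} => B.1.indicator 1

/-- The integral of the step function of a formal linear combination of sets. -/
def stepOp : SetComb →ₗ[ℂ] (H →L[ℂ] H) :=
  Finsupp.linearCombination ℂ fun B : {B : Set ℝ // MeasurableSet B} => E.proj B.1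

theorem stepFn_single (B : {B : Set ℝ // MeasurableSet B}) (c : ℂ) :
    stepFn (Finsupp.single B c) = c • B.1.indicator 1 := by
  simp [stepFn]

theorem stepOp_single (B : {B : Set ℝ // MeasurableSet B}) (c : ℂ) :
    E.stepOp (Finsupp.single B c) = c • E.proj B.1 := by
  simp [stepOp]

theorem measurable_stepFn (a : SetComb) : Measurable (stepFn a) := by
  induction a using Finsupp.induction_linear with
  | zero => rw [map_zero]; exact measurable_zero
  | add a b ha hb => rw [map_add]; exact ha.add hb
  | single B c =>
    rw [stepFn_single]
    exact (measurable_one.indicator B.2).const_smul c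

theorem bounded_stepFn (a : SetComb) : ∃ C : ℝ, ∀ s, ‖stepFn a s‖ ≤ C := by
  induction a using Finsupp.induction_linear with
  | zero => exact ⟨0, by simp⟩
  | add a b ha hb =>
    obtain ⟨C, hC⟩ := ha
    obtain ⟨C', hC'⟩ := hb
    refine ⟨C + C', fun s => ?_⟩
    rw [map_add]
    exact (norm_add_le _ _).trans (add_le_add (hC s) (hC' s))
  | single B c =>
    refine ⟨‖c‖, fun s => ?_⟩
    rw [stepFn_single]
    by_cases hs : s ∈ B.1 <;> simp [hs]

theorem integrable_stepFn_mul (a b : SetComb) (x : H) :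
    Integrable (fun s => (starRingEnd ℂ) (stepFn a s) * stepFn b s) (E.scalar x) := by
  obtain ⟨C, hC⟩ := bounded_stepFn a
  obtain ⟨C', hC'⟩ := bounded_stepFn b
  refine Integrable.of_bound (C := C * C') ?_ (.of_forall fun s => ?_)
  · exact ((continuous_star.measurable.comp (measurable_stepFn a)).mul
      (measurable_stepFn b)).aestronglyMeasurable
  · rw [norm_mul, RCLike.norm_conj]
    exact mul_le_mul (hC s) (hC' s) (norm_nonneg _) ((norm_nonneg _).trans (hC s))

/-- By sesquilinearity it suffices to treat two single sets, where the projections multiply to that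
of the intersection. It follows that the operator depends only on the step function, so formal
combinations need no separate check of well-definedness. -/
theorem inner_stepOp (a b : SetComb) (x : H) :
    ⟪E.stepOp a x, E.stepOp b x⟫_ℂ =
      ∫ s, (starRingEnd ℂ) (stepFn a s) * stepFn b s ∂(E.scalar x) := by
  induction a using Finsupp.induction_linear with
  | zero => simp
  | add a a' ha ha' =>
    rw [map_add, add_apply, inner_add_left, ha, ha',
      ← integral_add (E.integrable_stepFn_mul _ _ x) (E.integrable_stepFn_mul _ _ x)]
    simp [add_mul]
  | single A c =>
    induction b using Finsupp.induction_linear with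
    | zero => simp
    | add b b' hb hb' =>
      rw [map_add, add_apply, inner_add_right, hb, hb',
        ← integral_add (E.integrable_stepFn_mul _ _ x) (E.integrable_stepFn_mul _ _ x)]
      simp [mul_add]
    | single B c' =>
      rw [stepOp_single, stepOp_single, smul_apply, smul_apply,
        inner_smul_left, inner_smul_right, E.inner_proj_proj x A.2 B.2, stepFn_single,
        stepFn_single]
      have : ∀ s, (starRingEnd ℂ) ((c • A.1.indicator (1 : ℝ → ℂ)) s) *
          (c' • B.1.indicator (1 : ℝ → ℂ)) s =
          ((starRingEnd ℂ) c * c') * (A.1 ∩ B.1).indicator (1 : ℝ → ℂ) s := by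
        intro s
        by_cases h1 : s ∈ A.1 <;> by_cases h2 : s ∈ B.1 <;> simp [h1, h2]
      simp only [this]
      have hi : ∫ s, (A.1 ∩ B.1).indicator (1 : ℝ → ℂ) s ∂(E.scalar x) =
          ((E.scalar x).real (A.1 ∩ B.1) : ℂ) := by
        have := integral_indicator_const (μ := E.scalar x) (1 : ℂ) (A.2.inter B.2)
        rw [Complex.real_smul, mul_one] at this
        exact this
      rw [integral_const_mul, hi]
      ring

/-- The representation of the step functions defined by a projection-valued measure. -/
def rep : SpectralRep SetComb ℝ H where
  ev := stepFn
  op := E.stepOp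
  meas := E.scalar
  finite_meas := inferInstance
  measurable_ev := measurable_stepFn
  bounded_ev := bounded_stepFn
  norm_op_sq a x := by
    have h := E.inner_stepOp a a x
    rw [inner_self_eq_norm_sq_to_K] at h
    have h2 : ∀ s, (starRingEnd ℂ) (stepFn a s) * stepFn a s = ((‖stepFn a s‖ ^ 2 : ℝ) : ℂ) := by
      intro s
      rw [RCLike.conj_mul]
      simp
    simp only [h2] at h
    rw [integral_complex_ofReal] at h
    exact Complex.ofReal_injective (by simpa using h)
  exists_mul a b := by
    induction a using Finsupp.induction_linear with
    | zero => exact ⟨0, by simp⟩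
    | add a a' ha ha' =>
      obtain ⟨c, hc, hc'⟩ := ha
      obtain ⟨d, hd, hd'⟩ := ha'
      exact ⟨c + d, by rw [map_add, map_add, hc, hd, add_mul],
        by rw [map_add, map_add, hc', hd', add_mul]⟩
    | single A c =>
      induction b using Finsupp.induction_linear with
      | zero => exact ⟨0, by simp⟩
      | add b b' hb hb' =>
        obtain ⟨c, hc, hc'⟩ := hb
        obtain ⟨d, hd, hd'⟩ := hb'
        exact ⟨c + d, by rw [map_add, map_add, hc, hd, mul_add],
          by rw [map_add, map_add, hc', hd', mul_add]⟩
      | single B c' =>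
        refine ⟨Finsupp.single ⟨A.1 ∩ B.1, A.2.inter B.2⟩ (c * c'), ?_, ?_⟩
        · simp only [stepFn_single]
          ext s
          by_cases h1 : s ∈ A.1 <;> by_cases h2 : s ∈ B.1 <;> simp [h1, h2]
        · simp only [stepOp_single, E.proj_inter A B A.2 B.2]
          rw [smul_mul_smul_comm]
  exists_one := by
    refine ⟨Finsupp.single ⟨Set.univ, .univ⟩ 1, ?_, ?_⟩
    · simp [stepFn_single]
    · simp [stepOp_single, E.proj_univ]
  exists_approx ν _ g hg ε hε := by
    obtain ⟨f, hf, -⟩ := hg.exists_simpleFunc_eLpNorm_sub_lt (by simp) hε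
    have : ∃ a, stepFn a = f := by
      clear hf
      induction f using SimpleFunc.induction with
      | const c hs =>
        rename_i B
        refine ⟨Finsupp.single ⟨B, hs⟩ c, ?_⟩
        rw [stepFn_single]
        ext s
        by_cases h : s ∈ B <;> simp [h]
      | add hd h1 h2 =>
        obtain ⟨a, ha⟩ := h1
        obtain ⟨b, hb⟩ := h2
        exact ⟨a + b, by rw [map_add, ha, hb]; rfl⟩
    obtain ⟨a, ha⟩ := this
    exact ⟨a, by rw [ha]; exact hf.le⟩

theorem meas_rep (x : H) : E.rep.meas x = E.scalar x := rfl

/-- The operator `∫ g dE` acts as the isometric extension of the calculus of step functions. -/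
theorem integral_apply {g : ℝ → ℝ} (hg : Measurable g) {C : ℝ} (hC : ∀ s, |g s| ≤ C) (x : H) :
    E.integral g x = E.rep.vec x fun s => (g s : ℂ) := by
  have hgm : Measurable fun s => (g s : ℂ) := Complex.measurable_ofReal.comp hg
  have hgb : ∀ s, ‖(g s : ℂ)‖ ≤ C := fun s => by simpa using hC s
  let T := E.rep.fn (fun s => (g s : ℂ)) hgm ⟨C, hgb⟩
  have hT : ∀ x, ⟪x, T x⟫_ℂ = ((∫ s, g s ∂(E.scalar x) : ℝ) : ℂ) := by
    intro x
    change ⟪x, E.rep.vec x fun s => (g s : ℂ)⟫_ℂ = _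
    rw [SpectralRep.inner_self_vec (memLp_of_bounded hgm hgb _), E.meas_rep,
      integral_complex_ofReal]
  have hex : ∃ T : H →L[ℂ] H, ∀ x, ⟪x, T x⟫_ℂ = ((∫ s, g s ∂(E.scalar x) : ℝ) : ℂ) := ⟨T, hT⟩
  have h1 : E.integral g = hex.choose := dif_pos hex
  -- The chosen operator is known only through its quadratic form, which determines an operator on a
  -- complex space.
  have h2 : (hex.choose - T).toLinearMap = 0 := by
    refine (inner_map_self_eq_zero _).1 fun y => ?_
    have h := hex.choose_spec y
    rw [← hT y] at h
    have h3 : ⟪y, (hex.choose - T) y⟫_ℂ = 0 := by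
      rw [sub_apply, inner_sub_right, h, sub_self]
    exact inner_eq_zero_symm.1 h3
  have h3 : (hex.choose - T) x = 0 := congrArg (fun f : H →ₗ[ℂ] H => f x) h2
  rw [h1, ← sub_eq_zero]
  exact h3

variable {E}

theorem memLp_id_iff {x : H} :
    MemLp (fun s : ℝ => (s : ℂ)) 2 (E.scalar x) ↔ Integrable (fun s : ℝ => s ^ 2) (E.scalar x) := by
  rw [memLp_two_iff_integrable_sq_norm Complex.measurable_ofReal.aestronglyMeasurable]
  simp

namespace IsResolutionOf

variable {A : H →ₗ.[ℂ] H}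

theorem mem_domain_iff (hE : E.IsResolutionOf A) {x : H} :
    x ∈ A.domain ↔ MemLp (fun s : ℝ => (s : ℂ)) 2 (E.rep.meas x) := by
  rw [E.meas_rep, memLp_id_iff]
  exact hE.1 x

/-- The resolution fixes `A` only through its quadratic form. Polarization with x + y and x + iy
makes the difference of the two sides orthogonal to the domain, which is dense. -/
theorem apply_eq (hE : E.IsResolutionOf A) (hA : Dense (A.domain : Set H)) (x : A.domain) :
    A x = E.rep.vec x fun s => (s : ℂ) := by
  let V : A.domain →ₗ[ℂ] H :=
    { toFun := fun x => E.rep.vec x fun s => (s : ℂ)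
      map_add' := fun x y => SpectralRep.vec_add_left (hE.mem_domain_iff.1 x.2)
        (hE.mem_domain_iff.1 y.2) (hE.mem_domain_iff.1 (x + y).2)
      map_smul' := fun c x => (SpectralRep.vec_smul_left c Complex.measurable_ofReal
        (hE.mem_domain_iff.1 x.2)).2 }
  have hq : ∀ z : A.domain, ⟪(z : H), A z - V z⟫_ℂ = 0 := by
    intro z
    have h1 : ⟪(z : H), V z⟫_ℂ = ((∫ s, s ∂(E.scalar z) : ℝ) : ℂ) := by
      change ⟪(z : H), E.rep.vec z fun s => (s : ℂ)⟫_ℂ = _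
      rw [SpectralRep.inner_self_vec (hE.mem_domain_iff.1 z.2), E.meas_rep,
        integral_complex_ofReal]
    rw [inner_sub_right, h1, hE.2 z, sub_self]
  have hp : ∀ y : A.domain, ⟪(y : H), A x - V x⟫_ℂ = 0 := by
    intro y
    have h1 := hq (x + y)
    have h2 := hq (x + Complex.I • y)
    have hx := hq x
    have hy := hq y
    simp only [LinearPMap.map_add, LinearPMap.map_smul, map_add, map_smul, Submodule.coe_add,
      Submodule.coe_smul, inner_add_left, inner_sub_right, inner_add_right, inner_smul_left,
      inner_smul_right, Complex.conj_I] at h1 h2 hx hy ⊢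
    linear_combination (1 / 2 : ℂ) * h1 + (Complex.I / 2) * h2 - (1 / 2 + Complex.I / 2) * hx -
      (1 / 2 + Complex.I / 2) * hy + (⟪(y : H), A x⟫_ℂ - ⟪(y : H), V x⟫_ℂ -
      ⟪(x : H), A y⟫_ℂ + ⟪(x : H), V y⟫_ℂ +
      Complex.I * (⟪(y : H), A y⟫_ℂ - ⟪(y : H), V y⟫_ℂ)) / 2 * Complex.I_sq
  have h0 : A x - V x = 0 := by
    refine hA.eq_zero_of_inner_right (𝕜 := ℂ) fun y hy => hp ⟨y, hy⟩
  exact sub_eq_zero.1 h0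

theorem vec_mem_domain_iff (hE : E.IsResolutionOf A) {x : H} {g : ℝ → ℂ}
    (hm : Measurable g) (hg : MemLp g 2 (E.rep.meas x)) :
    E.rep.vec x g ∈ A.domain ↔ MemLp (fun s : ℝ => (s : ℂ) * g s) 2 (E.rep.meas x) := by
  rw [hE.mem_domain_iff]
  exact SpectralRep.memLp_vec_iff Complex.measurable_ofReal hm hg

theorem apply_vec (hE : E.IsResolutionOf A) (hA : Dense (A.domain : Set H)) {x : H}
    {g : ℝ → ℂ} (hm : Measurable g) (hg : MemLp g 2 (E.rep.meas x)) (h : E.rep.vec x g ∈ A.domain) :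
    A ⟨_, h⟩ = E.rep.vec x fun s : ℝ => (s : ℂ) * g s := by
  rw [hE.apply_eq hA]
  exact SpectralRep.vec_vec Complex.measurable_ofReal hm hg ((hE.vec_mem_domain_iff hm hg).1 h)

end IsResolutionOf

end PVM

theorem funCalc_eq {A : H →ₗ.[ℂ] H} (h : ∃ E : PVM H, E.IsResolutionOf A) :
    ∃ E : PVM H, E.IsResolutionOf A ∧ ∀ g, funCalc A g = E.integral g :=
  ⟨h.choose, h.choose_spec, fun _ => dif_pos h⟩

end PVMIntegration

/-! ### Existence of the spectral resolution of a self-adjoint operator -/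

section Resolvent

variable {H : Type*} [NormedAddCommGroup H] [InnerProductSpace ℂ H]

/-- The quadratic form of a symmetric operator is real, so the cross terms with an imaginary `c`
cancel. For |c| = 1 this makes `A + c` injective with inverse of norm at most 1. -/
theorem norm_sq_add_smul_of_symmetric {A : H →ₗ.[ℂ] H}
    (hA : ∀ x y : A.domain, ⟪A x, (y : H)⟫_ℂ = ⟪(x : H), A y⟫_ℂ) {c : ℂ}
    (hc : (starRingEnd ℂ) c = -c) (x : A.domain) :
    ‖A x + c • (x : H)‖ ^ 2 = ‖A x‖ ^ 2 + ‖c‖ ^ 2 * ‖(x : H)‖ ^ 2 := by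
  have h : ((‖A x + c • (x : H)‖ ^ 2 : ℝ) : ℂ) =
      ((‖A x‖ ^ 2 + ‖c‖ ^ 2 * ‖(x : H)‖ ^ 2 : ℝ) : ℂ) := by
    have h1 : ∀ z : H, ((‖z‖ ^ 2 : ℝ) : ℂ) = ⟪z, z⟫_ℂ := fun z => by
      rw [inner_self_eq_norm_sq_to_K]
      simp
    have h2 : ((‖c‖ ^ 2 : ℝ) : ℂ) = (starRingEnd ℂ) c * c := by
      rw [RCLike.conj_mul]
      simp
    rw [Complex.ofReal_add, Complex.ofReal_mul, h1, h1, h1, h2]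
    simp only [inner_add_left, inner_add_right, inner_smul_left, inner_smul_right, hA x x, hc]
    ring
  exact_mod_cast h

/-- The resolvent of a symmetric operator `A` at an imaginary number `-c` of modulus one
for which `A + c` is surjective. -/
theorem exists_resolvent {A : H →ₗ.[ℂ] H}
    (hA : ∀ x y : A.domain, ⟪A x, (y : H)⟫_ℂ = ⟪(x : H), A y⟫_ℂ) {c : ℂ}
    (hc : (starRingEnd ℂ) c = -c) (hc1 : ‖c‖ = 1)
    (hs : ∀ y, ∃ x : A.domain, A x + c • (x : H) = y) :
    ∃ R : H →L[ℂ] H, (∀ y, ∃ h : R y ∈ A.domain, A ⟨R y, h⟩ + c • R y = y) ∧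
      ∀ x : A.domain, R (A x + c • (x : H)) = x := by
  have hn := norm_sq_add_smul_of_symmetric hA hc
  have hinj : ∀ x y : A.domain, A x + c • (x : H) = A y + c • (y : H) → x = y := by
    intro x y h
    have h1 := hn (x - y)
    have h2 : A (x - y) + c • ((x - y : A.domain) : H) = 0 := by
      rw [LinearPMap.map_sub, Submodule.coe_sub, smul_sub, sub_add_sub_comm, h, sub_self]
    rw [h2, hc1] at h1
    have h3 : ‖((x - y : A.domain) : H)‖ ^ 2 = 0 := by
      simp only [norm_zero] at h1
      nlinarith [sq_nonneg ‖A (x - y)‖, sq_nonneg ‖((x - y : A.domain) : H)‖]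
    have h4 : ((x - y : A.domain) : H) = 0 := by simpa using h3
    rw [Submodule.coe_sub, sub_eq_zero] at h4
    exact Subtype.ext h4
  choose r hr using hs
  let R₀ : H →ₗ[ℂ] H :=
    { toFun := fun y => r y
      map_add' := fun y z => by
        have : r (y + z) = r y + r z := hinj _ _ (by
          rw [hr, LinearPMap.map_add, Submodule.coe_add, smul_add]
          nth_rewrite 1 [← hr y, ← hr z]
          abel)
        rw [this, Submodule.coe_add]
      map_smul' := fun a y => by
        have : r (a • y) = a • r y := hinj _ _ (by
          rw [hr, LinearPMap.map_smul, Submodule.coe_smul, smul_comm c a, ← smul_add, hr])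
        rw [this, Submodule.coe_smul, RingHom.id_apply] }
  have hb : ∀ y, ‖R₀ y‖ ≤ 1 * ‖y‖ := by
    intro y
    have h1 := hn (r y)
    rw [hr, hc1] at h1
    rw [one_mul]
    refine le_of_sq_le_sq ?_ (norm_nonneg _)
    change ‖(r y : H)‖ ^ 2 ≤ _
    nlinarith [sq_nonneg ‖A (r y)‖]
  refine ⟨R₀.mkContinuous 1 hb, fun y => ⟨(r y).2, hr y⟩, fun x => ?_⟩
  exact congrArg Subtype.val (hinj (r (A x + c • (x : H))) x (hr _))

end Resolvent

/-! ### Spectral measures of a representation of continuous functions, by the Riesz–Markov theorem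
-/

section ContinuousRep

variable {H : Type*} [NormedAddCommGroup H] [InnerProductSpace ℂ H] [CompleteSpace H]
  {X : Type*} [MetricSpace X]

/-- A real continuous function, seen as a complex one. -/
def ContinuousMap.complexify : C(X, ℝ) →ₗ[ℝ] C(X, ℂ) where
  toFun f := ⟨fun s => (f s : ℂ), by fun_prop⟩
  map_add' f g := by ext; simp
  map_smul' c f := by ext; simp

theorem inner_starHom_mul (Φ : C(X, ℂ) →⋆ₐ[ℂ] (H →L[ℂ] H)) (f : C(X, ℂ)) (x : H) :
    ⟪x, Φ (star f * f) x⟫_ℂ = ((‖Φ f x‖ ^ 2 : ℝ) : ℂ) := by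
  rw [map_mul, map_star, ContinuousLinearMap.star_eq_adjoint]
  change ⟪x, ContinuousLinearMap.adjoint (Φ f) (Φ f x)⟫_ℂ = _
  rw [ContinuousLinearMap.adjoint_inner_right, inner_self_eq_norm_sq_to_K]
  simp

variable [CompactSpace X] [MeasurableSpace X] [BorelSpace X]

/-- The positive functional `f ↦ ⟪x, Φ f x⟫` on the real continuous functions. -/
def vectorFunctional (Φ : C(X, ℂ) →⋆ₐ[ℂ] (H →L[ℂ] H)) (x : H) :
    CompactlySupportedContinuousMap X ℝ →ₚ[ℝ] ℝ :=
  PositiveLinearMap.mk₀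
    { toFun := fun f => (⟪x, Φ (ContinuousMap.complexify f.toContinuousMap) x⟫_ℂ).re
      map_add' := fun f g => by
        have : (f + g).toContinuousMap = f.toContinuousMap + g.toContinuousMap := rfl
        rw [this, map_add, map_add, add_apply, inner_add_right, Complex.add_re]
      map_smul' := fun c f => by
        have h1 : (c • f).toContinuousMap = c • f.toContinuousMap := rfl
        have h2 : c • ContinuousMap.complexify f.toContinuousMap =
          (c : ℂ) • ContinuousMap.complexify f.toContinuousMap := by ext; simp
        rw [h1, map_smul, h2, map_smul, smul_apply, inner_smul_right]
        simp }
    (by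
      intro f hf
      -- A nonnegative f equals star g * g for g = √f, so its value is ‖Φ(g)x‖².
      let g : C(X, ℂ) := ⟨fun s => ((Real.sqrt (f s) : ℝ) : ℂ), by fun_prop⟩
      have hg : ContinuousMap.complexify f.toContinuousMap = star g * g := by
        ext s
        have hs : 0 ≤ f s := hf s
        change ((f s : ℝ) : ℂ) = (starRingEnd ℂ) ((Real.sqrt (f s) : ℝ) : ℂ) *
          ((Real.sqrt (f s) : ℝ) : ℂ)
        rw [Complex.conj_ofReal, ← Complex.ofReal_mul, Real.mul_self_sqrt hs]
      change 0 ≤ (⟪x, Φ (ContinuousMap.complexify f.toContinuousMap) x⟫_ℂ).re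
      rw [hg, inner_starHom_mul, Complex.ofReal_re]
      positivity)

/-- The spectral measures of a `*`-representation of `C(X, ℂ)` turn it into a `SpectralRep`. -/
def continuousRep (Φ : C(X, ℂ) →⋆ₐ[ℂ] (H →L[ℂ] H)) : SpectralRep C(X, ℂ) X H where
  ev :=
    { toFun := fun f => f
      map_add' := fun _ _ => rfl
      map_smul' := fun _ _ => rfl }
  op := Φ.toAlgHom.toLinearMap
  meas x := RealRMK.rieszMeasure (vectorFunctional Φ x)
  finite_meas x := by
    have := RealRMK.regular_rieszMeasure (vectorFunctional Φ x)
    infer_instance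
  measurable_ev f := f.continuous.measurable
  bounded_ev f := ⟨‖f‖, f.norm_coe_le_norm⟩
  norm_op_sq f x := by
    let g : CompactlySupportedContinuousMap X ℝ :=
      { toFun := fun s => ‖f s‖ ^ 2
        continuous_toFun := by fun_prop
        hasCompactSupport' := HasCompactSupport.of_compactSpace _ }
    have h := RealRMK.integral_rieszMeasure (vectorFunctional Φ x) g
    have h2 : vectorFunctional Φ x g = ‖Φ f x‖ ^ 2 := by
      have hg : ContinuousMap.complexify g.toContinuousMap = star f * f := by
        ext s
        change ((‖f s‖ ^ 2 : ℝ) : ℂ) = (starRingEnd ℂ) (f s) * f s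
        rw [RCLike.conj_mul]
        simp
      change (⟪x, Φ (ContinuousMap.complexify g.toContinuousMap) x⟫_ℂ).re = _
      rw [hg, inner_starHom_mul, Complex.ofReal_re]
    exact (h.trans h2).symm
  exists_mul f g := ⟨f * g, rfl, map_mul Φ f g⟩
  exists_one := ⟨1, rfl, map_one Φ⟩
  exists_approx ν _ g hg ε hε := by
    obtain ⟨f, hf, -⟩ := hg.exists_boundedContinuous_eLpNorm_sub_le (by simp) hε
    exact ⟨f.toContinuousMap, hf⟩

end ContinuousRep

/-! ### Spectral projections and their transport to the real line -/

namespace SpectralRep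

variable {𝒜 X H : Type*} [AddCommGroup 𝒜] [Module ℂ 𝒜] [MeasurableSpace X]
  [NormedAddCommGroup H] [InnerProductSpace ℂ H] [CompleteSpace H] (S : SpectralRep 𝒜 X H)

theorem memLp_indicator_one {B : Set X} (hB : MeasurableSet B) (ν : Measure X)
    [IsFiniteMeasure ν] : MemLp (B.indicator (1 : X → ℂ)) 2 ν :=
  (memLp_const (1 : ℂ)).indicator hB

theorem eLpNorm_indicator_one_sq {B : Set X} (hB : MeasurableSet B) (ν : Measure X) :
    eLpNorm (B.indicator (1 : X → ℂ)) 2 ν ^ 2 = ν B := by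
  have h4 : ∀ s, ‖B.indicator (1 : X → ℂ) s‖ₑ ^ 2 = B.indicator 1 s := by
    intro s
    by_cases hs : s ∈ B <;> simp [hs]
  simp [eLpNorm_two_sq, h4, lintegral_indicator_one hB]

open Classical in
/-- The spectral projection of a measurable subset of `X`. -/
def proj (B : Set X) : H →L[ℂ] H :=
  if hB : MeasurableSet B then S.fn (B.indicator 1) (measurable_one.indicator hB)
    ⟨1, fun s => by by_cases hs : s ∈ B <;> simp [hs]⟩ else 0

theorem proj_apply {B : Set X} (hB : MeasurableSet B) (x : H) :
    S.proj B x = S.vec x (B.indicator 1) := by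
  rw [proj, dif_pos hB, fn_apply]

theorem enorm_proj_sq {B : Set X} (hB : MeasurableSet B) (x : H) :
    ‖S.proj B x‖ₑ ^ 2 = S.meas x B := by
  rw [S.proj_apply hB, enorm_vec (memLp_indicator_one hB _), eLpNorm_indicator_one_sq hB]

theorem proj_inter {A B : Set X} (hA : MeasurableSet A) (hB : MeasurableSet B) :
    S.proj (A ∩ B) = S.proj A * S.proj B := by
  ext x
  have h : A.indicator (1 : X → ℂ) * B.indicator 1 = (A ∩ B).indicator 1 := by
    ext s
    by_cases h1 : s ∈ A <;> by_cases h2 : s ∈ B <;> simp [h1, h2]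
  change _ = S.proj A (S.proj B x)
  rw [S.proj_apply hA, S.proj_apply hB, S.proj_apply (hA.inter hB),
    vec_vec (measurable_one.indicator hA) (measurable_one.indicator hB)
      (memLp_indicator_one hB _), h]
  rw [h]
  exact memLp_indicator_one (hA.inter hB) _

theorem isStarProjection_proj {B : Set X} (hB : MeasurableSet B) :
    IsStarProjection (S.proj B) := by
  refine ⟨?_, ?_⟩
  · rw [IsIdempotentElem, ← S.proj_inter hB hB, Set.inter_self]
  · rw [ContinuousLinearMap.isSelfAdjoint_iff_isSymmetric,
      LinearMap.isSymmetric_iff_inner_map_self_real]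
    intro x
    have h : ⟪x, S.proj B x⟫_ℂ = ((S.meas x).real B : ℂ) := by
      rw [S.proj_apply hB, inner_self_vec (memLp_indicator_one hB _)]
      have := integral_indicator_const (μ := S.meas x) (1 : ℂ) hB
      rw [Complex.real_smul, mul_one] at this
      exact this
    have h' : ⟪S.proj B x, x⟫_ℂ = ((S.meas x).real B : ℂ) := by
      rw [← inner_conj_symm, h, Complex.conj_ofReal]
    exact (congrArg _ h').trans ((Complex.conj_ofReal _).trans h'.symm)

/-- The error of a partial sum is the indicator of the union of the remaining sets. Its squared
L²-norm is the tail of a convergent series of measures. -/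
theorem hasSum_proj {A : ℕ → Set X} (hA : ∀ n, MeasurableSet (A n))
    (hd : Pairwise (Function.onFun Disjoint A)) (x : H) :
    HasSum (fun n => S.proj (A n) x) (S.proj (⋃ n, A n) x) := by
  have hU := MeasurableSet.iUnion hA
  have hfin : ∀ F : Finset ℕ, MemLp (fun s => ∑ n ∈ F, (A n).indicator (1 : X → ℂ) s) 2
      (S.meas x) := fun F => memLp_finsetSum F fun n _ => memLp_indicator_one (hA n) _
  have hsum : ∀ F : Finset ℕ, ∑ n ∈ F, S.proj (A n) x =
      S.vec x (fun s => ∑ n ∈ F, (A n).indicator 1 s) := by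
    intro F
    induction F using Finset.cons_induction with
    | empty =>
      simp only [Finset.sum_empty]
      exact (vec_zero x).symm
    | cons n F hn ih =>
      rw [Finset.sum_cons, ih, S.proj_apply (hA n),
        ← vec_add (memLp_indicator_one (hA n) _) (hfin F)]
      congr 1
      ext s
      rw [Finset.sum_cons]
      rfl
  rw [HasSum, S.proj_apply hU]
  simp only [hsum]
  refine tendsto_vec hfin (memLp_indicator_one hU _) ?_
  have hrest : ∀ F : Finset ℕ, MeasurableSet (⋃ n : {n // n ∉ F}, A n) :=
    fun F => MeasurableSet.iUnion fun n => hA n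
  have hdiff : ∀ F : Finset ℕ,
      (⋃ n, A n).indicator (1 : X → ℂ) - (fun s => ∑ n ∈ F, (A n).indicator (1 : X → ℂ) s) =
      (⋃ n : {n // n ∉ F}, A n).indicator 1 := by
    intro F
    ext s
    rw [Pi.sub_apply]
    by_cases hs : s ∈ ⋃ n, A n
    · obtain ⟨m, hm⟩ := Set.mem_iUnion.1 hs
      have hu : ∀ n, n ≠ m → s ∉ A n := fun n hn hs' =>
        Set.disjoint_left.1 (hd hn) hs' hm
      rw [Set.indicator_of_mem hs]
      by_cases hmF : m ∈ F
      · rw [Finset.sum_eq_single m (fun n _ hn => Set.indicator_of_notMem (hu n hn) _)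
          (fun h => absurd hmF h), Set.indicator_of_mem hm, Set.indicator_of_notMem, sub_self]
        rw [Set.mem_iUnion]
        rintro ⟨⟨n, hn⟩, hs'⟩
        exact hu n (fun h => hn (h ▸ hmF)) hs'
      · rw [Finset.sum_eq_zero (fun n hn => Set.indicator_of_notMem
          (hu n (fun h => hmF (h ▸ hn))) _), sub_zero, Set.indicator_of_mem]
        exact Set.mem_iUnion.2 ⟨⟨m, hmF⟩, hm⟩
    · have hu : ∀ n, s ∉ A n := fun n h => hs (Set.mem_iUnion.2 ⟨n, h⟩)
      rw [Set.indicator_of_notMem hs, Finset.sum_eq_zero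
        (fun n _ => Set.indicator_of_notMem (hu n) _), sub_zero, Set.indicator_of_notMem]
      simp [hu]
  have hmeas : Tendsto (fun F : Finset ℕ => S.meas x (⋃ n : {n // n ∉ F}, A n)) atTop (𝓝 0) := by
    have h1 : ∑' n, S.meas x (A n) ≠ ⊤ := by
      rw [← measure_iUnion hd hA]
      exact measure_ne_top _ _
    refine (ENNReal.tendsto_tsum_compl_atTop_zero h1).congr fun F => ?_
    exact (measure_iUnion (f := fun n : {n // n ∉ F} => A n)
      (fun m n hmn => hd fun h => hmn (Subtype.ext h)) fun n => hA n).symm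
  have hpow := (ENNReal.continuous_rpow_const (y := (1 / 2 : ℝ))).tendsto 0 |>.comp hmeas
  rw [ENNReal.zero_rpow_of_pos (by norm_num)] at hpow
  refine hpow.congr fun F => ?_
  rw [Function.comp_apply, ← eLpNorm_indicator_one_sq (hrest F), ← hdiff F, eLpNorm_sub_comm,
    ← ENNReal.rpow_natCast, ← ENNReal.rpow_mul]
  norm_num

/-- The projection-valued measure on `ℝ` obtained by transport along a measurable function. -/
def pvm (κ : X → ℝ) (hκ : Measurable κ) : PVM H where
  proj B := S.proj (κ ⁻¹' B)
  isStarProjection B hB := S.isStarProjection_proj (hκ hB)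
  proj_univ := by
    ext x
    rw [S.proj_apply (hκ .univ)]
    simpa using vec_one x
  proj_empty := by
    ext x
    rw [S.proj_apply (hκ .empty)]
    rw [Set.preimage_empty, Set.indicator_empty]
    exact vec_zero x
  proj_inter A B hA hB := S.proj_inter (hκ hA) (hκ hB)
  hasSum_proj A hA hd x := by
    rw [Set.preimage_iUnion]
    exact S.hasSum_proj (fun n => hκ (hA n)) (fun m n h => (hd h).preimage κ) x

theorem scalar_pvm (κ : X → ℝ) (hκ : Measurable κ) (x : H) :
    (S.pvm κ hκ).scalar x = (S.meas x).map κ := by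
  ext B hB
  rw [PVM.scalar_apply _ _ hB, Measure.map_apply hκ hB, ENNReal.ofReal_pow (norm_nonneg _),
    ofReal_norm]
  exact S.enorm_proj_sq (hκ hB) x

end SpectralRep

/-! ### Spectral resolution of an unbounded operator from its resolvents -/

section SpectralTheorem

variable {H : Type*} [NormedAddCommGroup H] [InnerProductSpace ℂ H] [CompleteSpace H]

/-- The spectral theorem: an operator `A` which is symmetric and such that `A ± i` are surjective
has a spectral resolution. -/
theorem exists_isResolutionOf {A : H →ₗ.[ℂ] H}
    (hA : ∀ x y : A.domain, ⟪A x, (y : H)⟫_ℂ = ⟪(x : H), A y⟫_ℂ)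
    (hp : ∀ y, ∃ x : A.domain, A x + Complex.I • (x : H) = y)
    (hm : ∀ y, ∃ x : A.domain, A x + (-Complex.I) • (x : H) = y) :
    ∃ E : PVM H, E.IsResolutionOf A := by
  -- R = (A + i)⁻¹ and Q = (A - i)⁻¹. The plan is to diagonalize the bounded normal operator R and
  -- to recover A as R⁻¹ - i.
  obtain ⟨R, hR, hR'⟩ := exists_resolvent hA (c := Complex.I) (by simp) (by simp) hp
  obtain ⟨Q, hQ, hQ'⟩ := exists_resolvent hA (c := -Complex.I) (by simp) (by simp) hm
  have hRinj : Function.Injective R := by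
    refine (injective_iff_map_eq_zero R).2 fun y hy => ?_
    obtain ⟨h, h'⟩ := hR y
    have h0 : (⟨R y, h⟩ : A.domain) = 0 := Subtype.ext hy
    rw [h0, LinearPMap.map_zero, hy] at h'
    simpa using h'.symm
  have hadj : star R = Q := by
    rw [ContinuousLinearMap.star_eq_adjoint, eq_comm, ContinuousLinearMap.eq_adjoint_iff]
    intro b a
    obtain ⟨hx, hx'⟩ := hR a
    obtain ⟨hy, hy'⟩ := hQ b
    have h := hA ⟨Q b, hy⟩ ⟨R a, hx⟩
    conv_lhs => rw [← hx']
    conv_rhs => rw [← hy']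
    simp only [inner_add_left, inner_add_right, inner_smul_left, inner_smul_right, h]
    simp
  -- The resolvent identity in both orders, Q = R + 2iQR and R = Q - 2iRQ; comparing them shows that
  -- Q = R* commutes with R.
  have hQR : ∀ a, Q a = R a + (2 * Complex.I) • Q (R a) := by
    intro a
    obtain ⟨hx, hx'⟩ := hR a
    have h := hQ' ⟨R a, hx⟩
    have e : a = (A ⟨R a, hx⟩ + (-Complex.I) • R a) + (2 * Complex.I) • R a := by
      conv_lhs => rw [← hx']
      module
    conv_lhs => rw [e, map_add, map_smul]
    exact congrArg (· + (2 * Complex.I) • Q (R a)) h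
  have hRQ : ∀ a, R a = Q a - (2 * Complex.I) • R (Q a) := by
    intro a
    obtain ⟨hx, hx'⟩ := hQ a
    have h := hR' ⟨Q a, hx⟩
    have e : a = (A ⟨Q a, hx⟩ + Complex.I • Q a) - (2 * Complex.I) • Q a := by
      conv_lhs => rw [← hx']
      module
    conv_lhs => rw [e, map_sub, map_smul]
    exact congrArg (· - (2 * Complex.I) • R (Q a)) h
  have hcomm : Q * R = R * Q := by
    ext a
    change Q (R a) = R (Q a)
    have h1 : (2 * Complex.I) • Q (R a) = Q a - R a := (sub_eq_of_eq_add' (hQR a)).symm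
    have h2 : (2 * Complex.I) • (Q (R a) - R (Q a)) = 0 := by
      rw [smul_sub, h1, hRQ a, sub_sub_self, sub_self]
    have h3 : Q (R a) - R (Q a) = 0 := (smul_eq_zero.1 h2).resolve_left (by simp)
    exact sub_eq_zero.1 h3
  have hnormal : IsStarNormal R := ⟨by rw [hadj]; exact hcomm⟩
  let Φ := cfcHom (R := ℂ) (a := R) hnormal
  let ι : C(spectrum ℂ R, ℂ) := (ContinuousMap.id ℂ).restrict (spectrum ℂ R)
  have hι : Φ ι = R := cfcHom_id hnormal
  -- The resolvent identity, read on the spectrum of R, says that 1/s has imaginary part 1 for s ≠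
  -- 0.
  have hspec : ∀ s : spectrum ℂ R, (starRingEnd ℂ) (s : ℂ) - s =
      2 * Complex.I * ((starRingEnd ℂ) (s : ℂ) * s) := by
    have h1 : Φ (star ι - ι) = Φ ((2 * Complex.I) • (star ι * ι)) := by
      rw [map_sub, map_smul, map_mul, map_star, hι, hadj]
      ext a
      change Q a - R a = (2 * Complex.I) • Q (R a)
      rw [hQR a]
      abel
    have h2 := (cfcHom_isClosedEmbedding (R := ℂ) (a := R) hnormal).injective h1
    intro s
    exact congrArg (fun f : C(spectrum ℂ R, ℂ) => f s) h2
  let S := continuousRep Φ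
  let r : spectrum ℂ R → ℂ := fun s => (s : ℂ)
  have hop : ∀ y, S.op ι y = R y := fun y => congrArg (fun T : H →L[ℂ] H => T y) hι
  have hev : S.ev ι = r := rfl
  have hrm : Measurable r := measurable_subtype_coe
  -- The value of A at the point s, since 1/s = κ + i. At s = 0 the convention 0⁻¹ = 0 gives κ = 0,
  -- which is harmless because that point is null by `hnull`.
  let κ : spectrum ℂ R → ℝ := fun s => ((s : ℂ)⁻¹).re
  have hκ : Measurable κ := Complex.measurable_re.comp hrm.inv
  have hinv : ∀ s : spectrum ℂ R, (s : ℂ) ≠ 0 → (s : ℂ) * (κ s + Complex.I) = 1 := by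
    intro s hs
    have h1 := hspec s
    have hs' : (starRingEnd ℂ) (s : ℂ) ≠ 0 := by simpa using hs
    have h2 : (s : ℂ)⁻¹ - (starRingEnd ℂ) (s : ℂ)⁻¹ = 2 * Complex.I := by
      rw [map_inv₀]
      field_simp
      linear_combination h1
    have h3 : ((s : ℂ)⁻¹).im = 1 := by
      have := congrArg Complex.im h2
      rw [Complex.sub_im, Complex.conj_im] at this
      have h4 : (2 * Complex.I).im = 2 := by simp
      linarith
    have h4 : (κ s : ℂ) + Complex.I = (s : ℂ)⁻¹ := by
      apply Complex.ext <;> simp [κ]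
      simpa using h3.symm
    rw [h4, mul_inv_cancel₀ hs]
  -- The injective operator R kills the range of the spectral projection of {s = 0}.
  have hnull : ∀ x, ∀ᵐ s ∂(S.meas x), r s ≠ 0 := by
    intro x
    have hB : MeasurableSet {s | r s = 0} := hrm (measurableSet_singleton 0)
    have h0 : S.proj {s | r s = 0} x = 0 := by
      refine hRinj ?_
      rw [map_zero, ← hop, S.proj_apply hB, SpectralRep.op_vec _
        (SpectralRep.memLp_indicator_one hB _), hev]
      have : r * {s | r s = 0}.indicator 1 = 0 := by
        ext s
        by_cases hs : r s = 0 <;> simp [hs]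
      rw [this, SpectralRep.vec_zero]
    have h1 := S.enorm_proj_sq hB x
    rw [h0] at h1
    rw [ae_iff]
    simpa using h1.symm
  have hκc : Measurable fun s => (κ s : ℂ) := Complex.measurable_ofReal.comp hκ
  -- Writing x = Ry turns the claim into square integrability of κ(s)s, which is bounded by 1.
  have hdom : ∀ x, x ∈ A.domain → MemLp (fun s => (κ s : ℂ)) 2 (S.meas x) := by
    intro x hx
    have h1 := hR' ⟨x, hx⟩
    set y := A ⟨x, hx⟩ + Complex.I • x with hy
    have h2 : x = S.vec y r := by
      rw [← hev, SpectralRep.vec_ev, hop]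
      exact h1.symm
    have hr : MemLp r 2 (S.meas y) := S.memLp_ev ι _
    rw [h2, SpectralRep.memLp_vec_iff hκc hrm hr]
    refine memLp_of_bounded (C := 1) (hκc.mul hrm) (fun s => ?_) _
    rw [Pi.mul_apply, norm_mul, Complex.norm_real]
    by_cases hs : r s = 0
    · simp [hs]
    · have h3 : ‖κ s‖ ≤ ‖(r s)⁻¹‖ := Complex.abs_re_le_norm _
      calc ‖κ s‖ * ‖r s‖ ≤ ‖(r s)⁻¹‖ * ‖r s‖ := by gcongr
        _ = 1 := by rw [← norm_mul, inv_mul_cancel₀ hs, norm_one]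
  -- Conversely, s(κ + i) = 1 almost everywhere puts such an x in the range of R, which is contained
  -- in the domain of A.
  have hvec : ∀ x, MemLp (fun s => (κ s : ℂ)) 2 (S.meas x) →
      R (S.vec x (fun s => (κ s : ℂ)) + Complex.I • x) = x := by
    intro x hx
    have h1 : MemLp (Complex.I • (1 : spectrum ℂ R → ℂ)) 2 (S.meas x) :=
      memLp_const (Complex.I • (1 : ℂ))
    have h2 : S.vec x (Complex.I • (1 : spectrum ℂ R → ℂ)) = Complex.I • x := by
      rw [SpectralRep.vec_const_smul (g := 1) _ (memLp_const (1 : ℂ)), SpectralRep.vec_one]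
    rw [← h2, ← SpectralRep.vec_add hx h1, ← hop, SpectralRep.op_vec _ (hx.add h1), hev]
    conv_rhs => rw [← SpectralRep.vec_one (S := S) x]
    refine SpectralRep.vec_congr ?_
    filter_upwards [hnull x] with s hs
    simpa using hinv s hs
  refine ⟨S.pvm κ hκ, fun x => ?_, fun x => ?_⟩
  · rw [← PVM.memLp_id_iff, S.scalar_pvm, memLp_map_measure_iff
      Complex.measurable_ofReal.aestronglyMeasurable hκ.aemeasurable]
    refine ⟨hdom x, fun hx => ?_⟩
    rw [← hvec x hx]
    exact (hR _).1
  · have hx := hdom x x.2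
    have h1 : S.vec x (fun s => (κ s : ℂ)) + Complex.I • (x : H) = A x + Complex.I • (x : H) :=
      hRinj ((hvec x hx).trans (hR' x).symm)
    rw [← add_right_cancel h1, SpectralRep.inner_self_vec hx, S.scalar_pvm,
      integral_map (f := fun s : ℝ => s) hκ.aemeasurable measurable_id.aestronglyMeasurable,
      integral_complex_ofReal]

end SpectralTheorem

/-! ### The Dirac operator and the Laplacian of a Hilbert complex -/

section HilbertComplex

variable {H : Type*} [NormedAddCommGroup H] [InnerProductSpace ℂ H]

/-- In terms of graphs, the domain conditions for sums and products become the existence of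
intermediate vectors. -/
theorem LinearPMap.mem_graph_add_iff {f g : H →ₗ.[ℂ] H} {x y : H} :
    (x, y) ∈ (f + g).graph ↔ ∃ u v, (x, u) ∈ f.graph ∧ (x, v) ∈ g.graph ∧ u + v = y := by
  simp only [LinearPMap.mem_graph_iff]
  constructor
  · rintro ⟨z, rfl, rfl⟩
    exact ⟨_, _, ⟨⟨z, z.2.1⟩, rfl, rfl⟩, ⟨⟨z, z.2.2⟩, rfl, rfl⟩, rfl⟩
  · rintro ⟨_, _, ⟨z, rfl, rfl⟩, ⟨z', hz, rfl⟩, rfl⟩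
    refine ⟨⟨z, z.2, hz ▸ z'.2⟩, rfl, ?_⟩
    have : (⟨z, hz ▸ z'.2⟩ : g.domain) = z' := Subtype.ext hz.symm
    exact congrArg (fun w => f z + g w) this

theorem mem_graph_opMul_iff {f g : H →ₗ.[ℂ] H} {x y : H} :
    (x, y) ∈ (opMul g f).graph ↔ ∃ u, (x, u) ∈ f.graph ∧ (u, y) ∈ g.graph := by
  simp only [LinearPMap.mem_graph_iff]
  constructor
  · rintro ⟨⟨z, ⟨w, hw, hwz⟩, hz⟩, rfl, rfl⟩
    exact ⟨f ⟨z, hz⟩, ⟨⟨z, hz⟩, rfl, rfl⟩, ⟨⟨f ⟨z, hz⟩, by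
      have : w = ⟨z, hz⟩ := Subtype.ext hwz
      rw [← this]
      exact hw⟩, rfl, rfl⟩⟩
  · rintro ⟨_, ⟨z, rfl, rfl⟩, ⟨w, hw, rfl⟩⟩
    have hz : f z ∈ g.domain := hw ▸ w.2
    refine ⟨⟨z, ⟨z, hz, rfl⟩, z.2⟩, rfl, ?_⟩
    have : w = ⟨f z, hz⟩ := Subtype.ext hw
    rw [this]
    rfl

variable [CompleteSpace H] {d : H →ₗ.[ℂ] H}

theorem mem_graph_adjoint_iff (hd : Dense (d.domain : Set H)) {z w : H} :
    (z, w) ∈ d†.graph ↔ ∀ x y, (x, y) ∈ d.graph → ⟪w, x⟫_ℂ = ⟪z, y⟫_ℂ := by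
  constructor
  · rintro h x y hxy
    obtain ⟨z', rfl, rfl⟩ := (LinearPMap.mem_graph_iff _).1 h
    obtain ⟨x', rfl, rfl⟩ := (LinearPMap.mem_graph_iff _).1 hxy
    exact LinearPMap.adjoint_isFormalAdjoint hd z' x'
  · intro h
    have h' : ∀ x : d.domain, ⟪w, (x : H)⟫_ℂ = ⟪z, d x⟫_ℂ := fun x => h _ _ (d.mem_graph x)
    have hz := LinearPMap.mem_adjoint_domain_of_exists (T := d) z ⟨w, h'⟩
    exact (LinearPMap.mem_graph_iff _).2 ⟨⟨z, hz⟩, rfl,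
      LinearPMap.adjoint_apply_eq hd ⟨z, hz⟩ h'⟩

/-- The orthogonal decomposition of `H × H` by the graph of a closed operator. -/
theorem exists_graph_decomposition (hc : d.IsClosed) (hd : Dense (d.domain : Set H)) (a b : H) :
    ∃ x y z w, (x, y) ∈ d.graph ∧ (z, w) ∈ d†.graph ∧ a = x - w ∧ b = y + z := by
  let K : Submodule ℂ (WithLp 2 (H × H)) :=
    d.graph.comap (WithLp.linearEquiv 2 ℂ (H × H)).toLinearMap
  have hK : IsClosed (K : Set (WithLp 2 (H × H))) :=
    IsClosed.preimage (WithLp.prod_continuous_ofLp 2 H H) hc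
  have : CompleteSpace K := hK.completeSpace_coe
  obtain ⟨p, hp, o, ho, hpo⟩ := K.exists_add_mem_mem_orthogonal (WithLp.toLp 2 (a, b))
  -- A pair orthogonal to the graph of d has the form (-w, z) with w = d†z.
  refine ⟨p.fst, p.snd, o.snd, -o.fst, hp, ?_, ?_, ?_⟩
  · rw [mem_graph_adjoint_iff hd]
    intro x y hxy
    have h := (Submodule.mem_orthogonal' K o).1 ho (WithLp.toLp 2 (x, y)) hxy
    rw [WithLp.prod_inner_apply] at h
    change ⟪o.fst, x⟫_ℂ + ⟪o.snd, y⟫_ℂ = 0 at h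
    rw [inner_neg_left]
    linear_combination -h
  · have := congrArg WithLp.fst hpo
    simpa using this
  · have := congrArg WithLp.snd hpo
    simpa using this

/-- If w = d†z, then ⟨w, dx⟩ = ⟨z, ddx⟩ = 0 for all x, so d†w = 0. -/
theorem adjoint_adjoint_of_complex (hd : Dense (d.domain : Set H))
    (hdd : ∀ x y, (x, y) ∈ d.graph → (y, (0 : H)) ∈ d.graph) :
    ∀ z w, (z, w) ∈ d†.graph → (w, (0 : H)) ∈ d†.graph := by
  intro z w h
  rw [mem_graph_adjoint_iff hd] at h ⊢
  intro x y hxy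
  rw [inner_zero_left, h y 0 (hdd x y hxy), inner_zero_right]

/-- The Laplacian of a Hilbert complex is the square of its Dirac operator. -/
theorem mem_graph_laplacian_iff (hd : Dense (d.domain : Set H))
    (hdd : ∀ x y, (x, y) ∈ d.graph → (y, (0 : H)) ∈ d.graph) {x y : H} :
    (x, y) ∈ (opMul d† d + opMul d d†).graph ↔
      ∃ u, (x, u) ∈ (d + d†).graph ∧ (u, y) ∈ (d + d†).graph := by
  have hdd' := adjoint_adjoint_of_complex hd hdd
  simp only [LinearPMap.mem_graph_add_iff, mem_graph_opMul_iff]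
  -- With p = dx in ker d and r = d†x in ker d†, the sum p + r is in dom d exactly when r is, and in
  -- dom d† exactly when p is. The domains therefore match.
  constructor
  · rintro ⟨u, v, ⟨p, hp, hp'⟩, ⟨r, hr, hr'⟩, rfl⟩
    refine ⟨p + r, ⟨p, r, hp, hr, rfl⟩, ⟨v, u, ?_, ?_, add_comm v u⟩⟩
    · simpa using add_mem (hdd _ _ hp) hr'
    · simpa using add_mem hp' (hdd' _ _ hr)
  · rintro ⟨_, ⟨p, r, hp, hr, rfl⟩, ⟨v, u, hv, hu, rfl⟩⟩
    refine ⟨u, v, ⟨p, hp, ?_⟩, ⟨r, hr, ?_⟩, add_comm u v⟩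
    · simpa using sub_mem hu (hdd' _ _ hr)
    · simpa using sub_mem hv (hdd _ _ hp)

theorem inner_dirac_of_mem_graph (hd : Dense (d.domain : Set H)) {x u y v : H}
    (hx : (x, u) ∈ (d + d†).graph) (hy : (y, v) ∈ (d + d†).graph) :
    ⟪u, y⟫_ℂ = ⟪x, v⟫_ℂ := by
  obtain ⟨p, r, hp, hr, rfl⟩ := LinearPMap.mem_graph_add_iff.1 hx
  obtain ⟨p', r', hp', hr', rfl⟩ := LinearPMap.mem_graph_add_iff.1 hy
  rw [mem_graph_adjoint_iff hd] at hr hr'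
  rw [inner_add_left, inner_add_right, hr _ _ hp', ← inner_conj_symm p y, ← hr' _ _ hp,
    inner_conj_symm, add_comm]

theorem symmetric_dirac (hd : Dense (d.domain : Set H)) (x y : (d + d†).domain) :
    ⟪(d + d†) x, (y : H)⟫_ℂ = ⟪(x : H), (d + d†) y⟫_ℂ :=
  inner_dirac_of_mem_graph hd (LinearPMap.mem_graph _ x) (LinearPMap.mem_graph _ y)

/-- The solution is x₂ = (1 + dd†)⁻¹(1 + d†d)⁻¹b. Decomposing (b, 0) along the graph of d gives x₁
with x₁ + d†dx₁ = b, and decomposing (0, x₁) gives x₂ with x₂ + dd†x₂ = x₁. Since d² = 0, dx₂ = dx₁,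
and the two equations add up. -/
theorem exists_laplacian_add_one_eq (hc : d.IsClosed) (hd : Dense (d.domain : Set H))
    (hdd : ∀ x y, (x, y) ∈ d.graph → (y, (0 : H)) ∈ d.graph) (b : H) :
    ∃ x y, (x, y) ∈ (opMul d† d + opMul d d†).graph ∧ y + x = b := by
  obtain ⟨x₁, y₁, z₁, w₁, h₁, h₁', e₁, e₁'⟩ := exists_graph_decomposition hc hd b 0
  obtain ⟨w₂, v, x₂, w₂', h₂, h₂', e₂, e₂'⟩ := exists_graph_decomposition hc hd 0 x₁
  obtain rfl : z₁ = -y₁ := by rw [eq_neg_iff_add_eq_zero, add_comm]; exact e₁'.symm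
  obtain rfl : w₂ = w₂' := sub_eq_zero.1 e₂.symm
  have h₁'' : (y₁, -w₁) ∈ d†.graph := by simpa using neg_mem h₁'
  have h₃ : (x₂, y₁) ∈ d.graph := by
    have := sub_mem h₁ (hdd _ _ h₂)
    rw [e₂'] at this
    simpa using this
  refine ⟨x₂, -w₁ + v, ?_, ?_⟩
  · rw [LinearPMap.mem_graph_add_iff]
    exact ⟨-w₁, v, mem_graph_opMul_iff.2 ⟨y₁, h₃, h₁''⟩, mem_graph_opMul_iff.2 ⟨w₂, h₂', h₂⟩, rfl⟩
  · rw [e₁, e₂']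
    abel

/-- As c² = -1, (D + c)(D - c) = D² + 1 = L + 1. So (D - c)x solves the equation when x solves (L +
1)x = b. -/
theorem exists_dirac_add_smul_eq (hc : d.IsClosed) (hd : Dense (d.domain : Set H))
    (hdd : ∀ x y, (x, y) ∈ d.graph → (y, (0 : H)) ∈ d.graph) {c : ℂ} (h1 : c * c = -1) (b : H) :
    ∃ x : (d + d†).domain, (d + d†) x + c • (x : H) = b := by
  obtain ⟨x, y, hxy, rfl⟩ := exists_laplacian_add_one_eq hc hd hdd b
  obtain ⟨u, hu, hu'⟩ := (mem_graph_laplacian_iff hd hdd).1 hxy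
  have h : (u - c • x, y - c • u) ∈ (d + d†).graph := sub_mem hu' (Submodule.smul_mem _ c hu)
  obtain ⟨z, hz, hz'⟩ := (LinearPMap.mem_graph_iff _).1 h
  refine ⟨z, ?_⟩
  rw [hz, hz', smul_sub, smul_smul, h1]
  module

/-- The Dirac operator of a Hilbert complex has a spectral resolution. -/
theorem exists_resolution_dirac (hc : d.IsClosed) (hd : Dense (d.domain : Set H))
    (hdd : ∀ x y, (x, y) ∈ d.graph → (y, (0 : H)) ∈ d.graph) :
    ∃ E : PVM H, E.IsResolutionOf (d + d†) :=
  exists_isResolutionOf (symmetric_dirac hd)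
    (exists_dirac_add_smul_eq hc hd hdd (by simp)) (exists_dirac_add_smul_eq hc hd hdd (by simp))

/-- Let z = (D + i)x be orthogonal to the domain and choose y with (D - i)y = x. Then ⟨x, x⟩ = ⟨x,
(D - i)y⟩ = ⟨z, y⟩ = 0. -/
theorem dense_domain_dirac (hc : d.IsClosed) (hd : Dense (d.domain : Set H))
    (hdd : ∀ x y, (x, y) ∈ d.graph → (y, (0 : H)) ∈ d.graph) :
    Dense ((d + d†).domain : Set H) := by
  rw [Submodule.dense_iff_topologicalClosure_eq_top, Submodule.topologicalClosure_eq_top_iff,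
    Submodule.eq_bot_iff]
  intro z hz
  obtain ⟨x, rfl⟩ := exists_dirac_add_smul_eq hc hd hdd (c := Complex.I) (by simp) z
  obtain ⟨y, hy⟩ := exists_dirac_add_smul_eq hc hd hdd (c := -Complex.I) (by simp) (x : H)
  have h := (Submodule.mem_orthogonal' _ _).1 hz y y.2
  rw [inner_add_left, symmetric_dirac hd, inner_smul_left] at h
  have h2 : ⟪(x : H), (d + d†) y + (-Complex.I) • (y : H)⟫_ℂ = 0 := by
    rw [inner_add_right, inner_smul_right]
    simpa using h
  rw [hy, inner_self_eq_zero] at h2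
  have h3 : x = 0 := Subtype.ext h2
  rw [h3]
  simp

end HilbertComplex

/-! ### Existence and bounds for the Bessel functions `φ_n` -/

section Bessel

/-- The coefficients of the power series of `φ_n` in the variable `r²`. -/
def besselCoeff (n k : ℕ) : ℝ :=
  (-1) ^ k / ∏ j ∈ Finset.range k, ((2 * j + 2 : ℝ) * (2 * j + n))

theorem besselCoeff_zero (n : ℕ) : besselCoeff n 0 = 1 := by
  simp [besselCoeff]

theorem besselCoeff_succ (n k : ℕ) :
    besselCoeff n (k + 1) = -besselCoeff n k / ((2 * k + 2) * (2 * k + n)) := by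
  rw [besselCoeff, besselCoeff, Finset.prod_range_succ, pow_succ, mul_neg_one, neg_div, neg_div,
    div_div]

/-- The coefficient form of φ_n'(r) = -(r/n) φ_{n+2}(r). -/
theorem succ_mul_besselCoeff {n : ℕ} (hn : 1 ≤ n) (k : ℕ) :
    (k + 1) * besselCoeff n (k + 1) = -(1 / (2 * n)) * besselCoeff (n + 2) k := by
  have hn' : (0 : ℝ) < n := by exact_mod_cast hn
  induction k with
  | zero =>
    rw [besselCoeff_succ, besselCoeff_zero, besselCoeff_zero]
    field_simp
    simp
  | succ k ih =>
    have h1 := besselCoeff_succ n (k + 1)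
    have h2 := besselCoeff_succ (n + 2) k
    push_cast at h1 h2 ⊢
    have hk : (0 : ℝ) ≤ k := k.cast_nonneg
    have e1 : besselCoeff n (k + 1) = -(1 / (2 * n)) * besselCoeff (n + 2) k / (k + 1) := by
      rw [← ih]
      field_simp
    rw [h1, h2, e1]
    have : (2 * k + (n + 2) : ℝ) ≠ 0 := by positivity
    have : (2 * (k + 1) + n : ℝ) ≠ 0 := by positivity
    field_simp
    ring

/-- Expressing φ_n' and φ_n'' through φ_{n+2} and φ_{n+4} turns the Bessel equation into a
three-term relation; this is its coefficient of z^(k+1). -/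
theorem besselCoeff_relation {n : ℕ} (hn : 1 ≤ n) (k : ℕ) :
    besselCoeff n (k + 1) - besselCoeff (n + 2) (k + 1) +
      1 / (n * (n + 2)) * besselCoeff (n + 4) k = 0 := by
  have hn' : (0 : ℝ) < n := by exact_mod_cast hn
  have hk : (0 : ℝ) ≤ k := k.cast_nonneg
  have h1 := succ_mul_besselCoeff hn k
  have h2 := succ_mul_besselCoeff (n := n + 2) (by omega) k
  have h3 := besselCoeff_succ (n + 2) k
  push_cast at h1 h2 h3
  have e2 : besselCoeff (n + 4) k = -(2 * (n + 2)) * ((k + 1) * besselCoeff (n + 2) (k + 1)) := by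
    rw [h2]
    field_simp
  have e1 : besselCoeff n (k + 1) = -(1 / (2 * n)) * besselCoeff (n + 2) k / (k + 1) := by
    rw [← h1]
    field_simp
  rw [e2, e1, h3]
  have : (2 * k + (n + 2) : ℝ) ≠ 0 := by positivity
  field_simp
  ring

theorem abs_besselCoeff_le {n : ℕ} (hn : 1 ≤ n) (k : ℕ) :
    |besselCoeff n k| ≤ 1 / (k.factorial : ℝ) := by
  have hn' : (1 : ℝ) ≤ n := by exact_mod_cast hn
  induction k with
  | zero => simp [besselCoeff_zero]
  | succ k ih =>
    have hk : (0 : ℝ) ≤ k := k.cast_nonneg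
    rw [besselCoeff_succ, abs_div, abs_neg, abs_of_pos (by positivity : (0 : ℝ) <
      (2 * k + 2) * (2 * k + n)), Nat.factorial_succ]
    push_cast
    rw [one_div, mul_comm ((k : ℝ) + 1), mul_inv, ← one_div, ← div_eq_mul_inv]
    have : (k : ℝ) + 1 ≤ (2 * k + 2) * (2 * k + n) := by nlinarith
    gcongr

/-- The power series of `φ_n` in the variable `z = r²`. -/
def besselSeries (n : ℕ) (z : ℝ) : ℝ := ∑' k, besselCoeff n k * z ^ k

theorem summable_besselSeries {n : ℕ} (hn : 1 ≤ n) (z : ℝ) :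
    Summable fun k => besselCoeff n k * z ^ k := by
  refine Summable.of_norm_bounded (Real.summable_pow_div_factorial |z|) fun k => ?_
  rw [Real.norm_eq_abs, abs_mul, abs_pow]
  calc |besselCoeff n k| * |z| ^ k ≤ 1 / (k.factorial : ℝ) * |z| ^ k := by
        gcongr
        exact abs_besselCoeff_le hn k
    _ = |z| ^ k / k.factorial := by ring

theorem besselSeries_zero (n : ℕ) : besselSeries n 0 = 1 := by
  rw [besselSeries, tsum_eq_single 0]
  · simp [besselCoeff_zero]
  · intro k hk
    simp [hk]

theorem hasDerivAt_besselSeries {n : ℕ} (hn : 1 ≤ n) (z : ℝ) :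
    HasDerivAt (besselSeries n) (-(1 / (2 * n)) * besselSeries (n + 2) z) z := by
  let r : ℝ := |z| + 1
  have hterm : ∀ (k : ℕ) (y : ℝ), ((k + 1 : ℕ) : ℝ) * besselCoeff n (k + 1) * y ^ k =
      -(1 / (2 * n)) * (besselCoeff (n + 2) k * y ^ k) := by
    intro k y
    push_cast
    rw [succ_mul_besselCoeff hn]
    ring
  have hu : Summable fun k : ℕ => |k * besselCoeff n k * r ^ (k - 1)| := by
    rw [← summable_nat_add_iff 1]
    simp only [Nat.add_sub_cancel, hterm]
    exact ((summable_besselSeries (n := n + 2) (by omega) r).mul_left _).abs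
  have h := hasDerivAt_tsum_of_isPreconnected (g := fun k y => besselCoeff n k * y ^ k)
    (g' := fun k y => k * besselCoeff n k * y ^ (k - 1)) (t := Metric.ball 0 r) (y₀ := 0) (y := z)
    hu Metric.isOpen_ball (convex_ball 0 r).isPreconnected
    (fun k y _ => by
      refine ((hasDerivAt_pow k y).const_mul (besselCoeff n k)).congr_deriv ?_
      ring)
    (fun k y hy => by
      rw [Real.norm_eq_abs, abs_mul, abs_mul, abs_pow, abs_mul, abs_mul, abs_pow]
      have hy' : |y| ≤ |r| := by
        rw [Metric.mem_ball, dist_zero_right, Real.norm_eq_abs] at hy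
        exact hy.le.trans (le_abs_self r)
      gcongr)
    (Metric.mem_ball_self (by positivity)) (summable_besselSeries hn 0)
    (by
      rw [Metric.mem_ball, dist_zero_right, Real.norm_eq_abs]
      exact lt_add_one _)
  refine h.congr_deriv ?_
  have hu' : Summable fun k : ℕ => (k : ℝ) * besselCoeff n k * z ^ (k - 1) := by
    rw [← summable_nat_add_iff 1]
    simp only [Nat.add_sub_cancel, hterm]
    exact (summable_besselSeries (n := n + 2) (by omega) z).mul_left _
  rw [hu'.tsum_eq_zero_add]
  simp only [Nat.add_sub_cancel, hterm]
  rw [tsum_mul_left]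
  simp [besselSeries]

theorem besselSeries_relation {n : ℕ} (hn : 1 ≤ n) (z : ℝ) :
    besselSeries n z - besselSeries (n + 2) z +
      z / (n * (n + 2)) * besselSeries (n + 4) z = 0 := by
  have h1 := summable_besselSeries hn z
  have h2 := summable_besselSeries (n := n + 2) (by omega) z
  have h3 := summable_besselSeries (n := n + 4) (by omega) z
  rw [besselSeries, besselSeries, besselSeries, h1.tsum_eq_zero_add, h2.tsum_eq_zero_add,
    besselCoeff_zero, besselCoeff_zero, ← tsum_mul_left, add_sub_add_left_eq_sub,
    ← ((summable_nat_add_iff 1).2 h1).tsum_sub ((summable_nat_add_iff 1).2 h2),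
    ← (((summable_nat_add_iff 1).2 h1).sub ((summable_nat_add_iff 1).2 h2)).tsum_add
      (h3.mul_left _)]
  have : ∀ k, besselCoeff n (k + 1) * z ^ (k + 1) - besselCoeff (n + 2) (k + 1) * z ^ (k + 1) +
      z / (n * (n + 2)) * (besselCoeff (n + 4) k * z ^ k) = 0 := by
    intro k
    have := besselCoeff_relation hn k
    linear_combination z ^ (k + 1) * this
  simp only [this, tsum_zero]

/-- Induction with `n` free, because each derivative shifts `n` to `n + 2`. -/
theorem contDiff_besselSeries (m : ℕ) {n : ℕ} (hn : 1 ≤ n) : ContDiff ℝ m (besselSeries n) := by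
  induction m generalizing n with
  | zero =>
    exact contDiff_zero.2
      (continuous_iff_continuousAt.2 fun z => (hasDerivAt_besselSeries hn z).continuousAt)
  | succ m ih =>
    push_cast
    rw [contDiff_succ_iff_deriv]
    refine ⟨fun z => (hasDerivAt_besselSeries hn z).differentiableAt, by simp, ?_⟩
    have : deriv (besselSeries n) = fun z => -(1 / (2 * n)) * besselSeries (n + 2) z :=
      funext fun z => (hasDerivAt_besselSeries hn z).deriv
    rw [this]
    exact contDiff_const.mul (ih (by omega))

theorem hasDerivAt_besselSeries_sq {n : ℕ} (hn : 1 ≤ n) (r : ℝ) :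
    HasDerivAt (fun r => besselSeries n (r ^ 2)) (-(r / n) * besselSeries (n + 2) (r ^ 2)) r := by
  have hn' : (n : ℝ) ≠ 0 := by positivity
  refine ((hasDerivAt_besselSeries hn (r ^ 2)).comp r (hasDerivAt_pow 2 r)).congr_deriv ?_
  field_simp
  norm_num
  ring

theorem isBesselSolution_besselSeries {n : ℕ} (hn : 1 ≤ n) :
    IsBesselSolution n fun r => besselSeries n (r ^ 2) := by
  have hn' : (n : ℝ) ≠ 0 := by positivity
  have hd : deriv (fun r => besselSeries n (r ^ 2)) =
      fun r => -(r / n) * besselSeries (n + 2) (r ^ 2) :=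
    funext fun r => (hasDerivAt_besselSeries_sq hn r).deriv
  refine ⟨?_, fun r hr => ?_, ?_, ?_⟩
  · exact (contDiff_besselSeries 2 hn).comp (contDiff_id.pow 2)
  · have h2 : HasDerivAt (fun r : ℝ => -(r / n) * besselSeries (n + 2) (r ^ 2)) _ r :=
      (((hasDerivAt_id r).div_const (n : ℝ)).neg).mul
        (hasDerivAt_besselSeries_sq (n := n + 2) (by omega) r)
    rw [hd, h2.deriv]
    have h3 := besselSeries_relation hn (r ^ 2)
    have : (n : ℝ) + 2 ≠ 0 := by positivity
    simp only [Pi.neg_apply, id]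
    push_cast
    field_simp at h3 ⊢
    linear_combination h3
  · simpa using besselSeries_zero n
  · rw [hd]
    simp

theorem isBesselSolution_besselPhi {n : ℕ} (hn : 1 ≤ n) : IsBesselSolution n (besselPhi n) := by
  have h : ∃ f, IsBesselSolution n f := ⟨_, isBesselSolution_besselSeries hn⟩
  rw [besselPhi, dif_pos h]
  exact h.choose_spec

namespace IsBesselSolution

variable {n : ℕ} {f : ℝ → ℝ}

theorem differentiable (h : IsBesselSolution n f) : Differentiable ℝ f :=
  h.contDiff.differentiable (by norm_num)

theorem contDiff_deriv (h : IsBesselSolution n f) : ContDiff ℝ 1 (deriv f) := by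
  have h2 : ContDiff ℝ (1 + 1) f := by
    rw [one_add_one_eq_two]
    exact h.contDiff
  exact (contDiff_succ_iff_deriv.1 h2).2.2

theorem differentiable_deriv (h : IsBesselSolution n f) : Differentiable ℝ (deriv f) :=
  h.contDiff_deriv.differentiable (by norm_num)

theorem continuous_deriv_deriv (h : IsBesselSolution n f) : Continuous (deriv (deriv f)) :=
  h.contDiff_deriv.continuous_deriv (by norm_num)

/-- The energy `f² + f'²` is at most its value at the origin. -/
theorem energy_le (h : IsBesselSolution n f) (hn : 1 ≤ n) (r : ℝ) :
    f r ^ 2 + deriv f r ^ 2 ≤ 1 := by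
  have hn' : (0 : ℝ) ≤ (n : ℝ) - 1 := by
    have : (1 : ℝ) ≤ n := by exact_mod_cast hn
    linarith
  let e : ℝ → ℝ := fun r => f r ^ 2 + deriv f r ^ 2
  have he : ∀ r, HasDerivAt e (2 * f r * deriv f r + 2 * deriv f r * deriv (deriv f) r) r := by
    intro r
    refine (((h.differentiable r).hasDerivAt.pow 2).add
      ((h.differentiable_deriv r).hasDerivAt.pow 2)).congr_deriv ?_
    norm_num
  -- The Bessel equation acts as friction: the energy falls as r moves away from 0 in either
  -- direction, because n ≥ 1.
  have he' : ∀ r, r ≠ 0 → deriv e r = -(2 * (n - 1) * deriv f r ^ 2) / r := by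
    intro r hr
    rw [(he r).deriv]
    have := h.ode r hr
    field_simp at this ⊢
    linear_combination deriv f r * this
  have hc : Continuous e := continuous_iff_continuousAt.2 fun r => (he r).continuousAt
  have hd : Differentiable ℝ e := fun r => (he r).differentiableAt
  have h0 : e 0 = 1 := by
    simp [e, h.init, h.init_deriv]
  change e r ≤ 1
  rw [← h0]
  rcases le_total 0 r with hr | hr
  · refine antitoneOn_of_deriv_nonpos (convex_Ici 0) hc.continuousOn hd.differentiableOn
      (fun s hs => ?_) (Set.self_mem_Ici) hr hr
    rw [interior_Ici] at hs
    have hs' : (0 : ℝ) < s := hs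
    rw [he' s hs'.ne', neg_div]
    exact neg_nonpos.2 (by positivity)
  · refine monotoneOn_of_deriv_nonneg (convex_Iic 0) hc.continuousOn hd.differentiableOn
      (fun s hs => ?_) hr (Set.self_mem_Iic) hr
    rw [interior_Iic] at hs
    have hs' : s < (0 : ℝ) := hs
    rw [he' s hs'.ne]
    exact div_nonneg_of_nonpos (neg_nonpos.2 (by positivity)) hs'.le

theorem abs_le_one (h : IsBesselSolution n f) (hn : 1 ≤ n) (r : ℝ) : |f r| ≤ 1 := by
  rw [← sq_le_one_iff_abs_le_one]
  nlinarith [h.energy_le hn r, sq_nonneg (deriv f r)]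

theorem abs_deriv_le_one (h : IsBesselSolution n f) (hn : 1 ≤ n) (r : ℝ) : |deriv f r| ≤ 1 := by
  rw [← sq_le_one_iff_abs_le_one]
  nlinarith [h.energy_le hn r, sq_nonneg (f r)]

/-- The equation is singular at 0, so compactness is used on [-1, 1]. Outside that interval |f'/r| ≤
1, and solving for f'' gives the bound n. -/
theorem exists_abs_deriv_deriv_le (h : IsBesselSolution n f) (hn : 1 ≤ n) :
    ∃ C : ℝ, ∀ r, |deriv (deriv f) r| ≤ C := by
  have hn' : (0 : ℝ) ≤ (n : ℝ) - 1 := by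
    have : (1 : ℝ) ≤ n := by exact_mod_cast hn
    linarith
  obtain ⟨C, hC⟩ := (isCompact_Icc (a := (-1 : ℝ)) (b := 1)).exists_bound_of_continuousOn
    h.continuous_deriv_deriv.continuousOn
  refine ⟨max C n, fun r => ?_⟩
  rcases le_or_gt |r| 1 with hr | hr
  · exact (hC r (abs_le.1 hr)).trans (le_max_left _ _)
  · refine le_trans ?_ (le_max_right _ _)
    have hr0 : r ≠ 0 := by
      rintro rfl
      simp at hr
      linarith
    have h1 : deriv (deriv f) r = -(((n : ℝ) - 1) * (deriv f r / r)) - f r := by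
      linear_combination h.ode r hr0
    have h2 : |deriv f r / r| ≤ 1 := by
      rw [abs_div]
      exact div_le_one_of_le₀ ((h.abs_deriv_le_one hn r).trans hr.le) (abs_nonneg _)
    calc |deriv (deriv f) r| ≤ |((n : ℝ) - 1) * (deriv f r / r)| + |f r| := by
          rw [h1]
          exact (abs_sub _ _).trans (by rw [abs_neg])
      _ ≤ ((n : ℝ) - 1) * 1 + 1 := by
          rw [abs_mul, abs_of_nonneg hn']
          gcongr
          exact h.abs_le_one hn r
      _ = n := by ring

end IsBesselSolution

end Bessel

/-! ### The exterior derivative as a closed operator -/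

section ExteriorDerivative

variable {q : ℕ}

theorem formCoeff_zero (k : ℕ) : formCoeff (0 : AltForm q k) = 0 := by
  ext I
  simp [formCoeff]

theorem formCoeff_apply {k : ℕ} (α : AltForm q k) {I : Finset (Fin q)} (h : I.card = k) :
    formCoeff α I = α fun i => EuclideanSpace.single (I.orderEmbOfFin h i) (1 : ℝ) := by
  simp [formCoeff, h]

theorem formCoeff_apply_of_ne {k : ℕ} (α : AltForm q k) {I : Finset (Fin q)} (h : I.card ≠ k) :
    formCoeff α I = 0 := by
  simp [formCoeff, h]

theorem continuous_formCoeff {k : ℕ} {ω : Rn q → AltForm q k} (hω : Continuous ω) :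
    Continuous fun x => formCoeff (ω x) := by
  refine (PiLp.continuous_toLp 2 _).comp (continuous_pi fun I => ?_)
  by_cases h : I.card = k
  · simp only [h, dite_true]
    fun_prop
  · simp only [h, dite_false]
    exact continuous_const

theorem memLp_formCoeff {k : ℕ} {ω : Rn q → AltForm q k} (hω : Continuous ω)
    (hs : HasCompactSupport ω) :
    MemLp (fun x => formCoeff (ω x)) 2 (volume : Measure (Rn q)) :=
  (continuous_formCoeff hω).memLp_of_hasCompactSupport (hs.comp_left (formCoeff_zero k))

theorem contDiff_extDeriv {k : ℕ} {ω : Rn q → AltForm q k} (hω : ContDiff ℝ (⊤ : ℕ∞) ω) :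
    ContDiff ℝ (⊤ : ℕ∞) (extDeriv ω) := by
  have h : ContDiff ℝ (⊤ : ℕ∞) (fderiv ℝ ω) := hω.fderiv_right (by simp)
  exact (ContinuousAlternatingMap.alternatizeUncurryFinCLM ℝ (Rn q) ℂ (n := k)).contDiff.comp h

theorem hasCompactSupport_extDeriv {k : ℕ} {ω : Rn q → AltForm q k} (hs : HasCompactSupport ω) :
    HasCompactSupport (extDeriv ω) :=
  (hs.fderiv ℝ).comp_left (map_zero (ContinuousAlternatingMap.alternatizeUncurryFinCLM ℝ (Rn q) ℂ))

/-- The form `conj ψ dx_I`, as a vector of coordinates. -/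
def coordFn (ψ : Rn q → ℂ) (I : Finset (Fin q)) (x : Rn q) : FormFibre q :=
  EuclideanSpace.single I ((starRingEnd ℂ) (ψ x))

theorem memLp_coordFn {ψ : Rn q → ℂ} (hψ : Continuous ψ) (hs : HasCompactSupport ψ)
    (I : Finset (Fin q)) : MemLp (coordFn ψ I) 2 (volume : Measure (Rn q)) := by
  refine Continuous.memLp_of_hasCompactSupport ?_ ?_
  · refine (PiLp.continuous_toLp 2 _).comp (continuous_pi fun J => ?_)
    by_cases h : J = I
    · subst h
      simp only [Pi.single_eq_same]
      fun_prop
    · simp only [Pi.single_eq_of_ne h]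
      exact continuous_const
  · exact hs.comp_left (g := fun z => EuclideanSpace.single I ((starRingEnd ℂ) z)) (by simp)

theorem inner_coordFn {ψ : Rn q → ℂ} {I : Finset (Fin q)}
    (h : MemLp (coordFn ψ I) 2 (volume : Measure (Rn q))) (y : FormSpace q) :
    ⟪h.toLp, y⟫_ℂ = ∫ x, ψ x * (y : Rn q → FormFibre q) x I := by
  rw [L2.inner_def]
  refine integral_congr_ae ?_
  filter_upwards [h.coeFn_toLp] with x hx
  rw [hx, coordFn, EuclideanSpace.inner_single_left, Complex.conj_conj]

/-- The fundamental lemma of the calculus of variations, applied to each coordinate; it serves both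
closability and density of the domain. -/
theorem eq_zero_of_integral_coord_eq_zero {y : FormSpace q}
    (h : ∀ (I : Finset (Fin q)) (ψ : Rn q → ℝ), ContDiff ℝ (⊤ : ℕ∞) ψ → HasCompactSupport ψ →
      ∫ x, (ψ x : ℂ) * (y : Rn q → FormFibre q) x I = 0) : y = 0 := by
  have hI : ∀ I : Finset (Fin q), ∀ᵐ x : Rn q, (y : Rn q → FormFibre q) x I = 0 := by
    intro I
    refine ae_eq_zero_of_integral_contDiff_smul_eq_zero ?_ fun ψ hψ hs => ?_
    · have h1 : MemLp (fun x => (y : Rn q → FormFibre q) x I) 2 (volume : Measure (Rn q)) :=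
        (EuclideanSpace.proj (𝕜 := ℂ) I).comp_memLp' (Lp.memLp y)
      exact h1.locallyIntegrable (by norm_num)
    · simpa only [Complex.real_smul] using h I ψ hψ hs
  refine Lp.ext ?_
  filter_upwards [ae_all_iff.2 hI, Lp.coeFn_zero (FormFibre q) 2 (volume : Measure (Rn q))]
    with x hx h0
  rw [h0]
  ext I
  exact hx I

/-- Matches the omission of the j-th argument in the formula for dω with the removal of the j-th
index from I. -/
theorem orderEmbOfFin_erase {m : ℕ} {I : Finset (Fin q)} (h : I.card = m + 1) (j : Fin (m + 1))
    (h' : (I.erase (I.orderEmbOfFin h j)).card = m) :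
    (fun i => I.orderEmbOfFin h (j.succAbove i)) =
      (I.erase (I.orderEmbOfFin h j)).orderEmbOfFin h' := by
  refine Finset.orderEmbOfFin_unique h' (fun i => ?_) fun a b hab => ?_
  · rw [Finset.mem_erase]
    exact ⟨fun e => Fin.succAbove_ne j i ((I.orderEmbOfFin h).injective e),
      Finset.orderEmbOfFin_mem I h _⟩
  · exact (I.orderEmbOfFin h).strictMono (Fin.strictMono_succAbove j hab)

theorem card_erase_orderEmbOfFin {m : ℕ} {I : Finset (Fin q)} (h : I.card = m + 1)
    (j : Fin (m + 1)) : (I.erase (I.orderEmbOfFin h j)).card = m := by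
  rw [Finset.card_erase_of_mem (Finset.orderEmbOfFin_mem I h j), h, Nat.add_sub_cancel]

theorem contDiff_form_apply {k : ℕ} {ω : Rn q → AltForm q k} (hω : ContDiff ℝ (⊤ : ℕ∞) ω)
    (v : Fin k → Rn q) : ContDiff ℝ (⊤ : ℕ∞) fun x => ω x v :=
  (ContinuousAlternatingMap.apply ℝ (Rn q) ℂ v).contDiff.comp hω

/-- Integration by parts for the coordinates of the exterior derivative. -/
theorem integral_mul_coeff_extDeriv {m : ℕ} {ω : Rn q → AltForm q m}
    (hω : ContDiff ℝ (⊤ : ℕ∞) ω) (hs : HasCompactSupport ω) {ψ : Rn q → ℂ}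
    (hψ : ContDiff ℝ (⊤ : ℕ∞) ψ) (hψs : HasCompactSupport ψ) {I : Finset (Fin q)}
    (h : I.card = m + 1) :
    ∫ x, ψ x * formCoeff (extDeriv ω x) I =
      ∑ j : Fin (m + 1), -(-1 : ℂ) ^ (j : ℕ) *
        ∫ x, fderiv ℝ ψ x (EuclideanSpace.single (I.orderEmbOfFin h j) 1) *
          formCoeff (ω x) (I.erase (I.orderEmbOfFin h j)) := by
  let v : Fin (m + 1) → Rn q := fun i => EuclideanSpace.single (I.orderEmbOfFin h i) (1 : ℝ)
  have hv : ∀ x j, formCoeff (ω x) (I.erase (I.orderEmbOfFin h j)) = ω x (j.removeNth v) := by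
    intro x j
    rw [formCoeff_apply _ (card_erase_orderEmbOfFin h j), ← orderEmbOfFin_erase h j]
    rfl
  have hωv : ∀ j : Fin (m + 1), ContDiff ℝ (⊤ : ℕ∞) fun x => ω x (j.removeNth v) :=
    fun j => contDiff_form_apply hω _
  have hωs : ∀ j : Fin (m + 1), HasCompactSupport fun x => ω x (j.removeNth v) := fun j =>
    hs.comp_left (g := fun α : AltForm q m => α (j.removeNth v)) (by simp)
  have hψd : Differentiable ℝ ψ := hψ.differentiable (by simp)
  have hωd : ∀ j : Fin (m + 1), Differentiable ℝ fun x => ω x (j.removeNth v) :=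
    fun j => (hωv j).differentiable (by simp)
  have hi1 : ∀ j, Integrable (fun x => ψ x * fderiv ℝ (fun x => ω x (j.removeNth v)) x (v j)) := by
    intro j
    refine Continuous.integrable_of_hasCompactSupport ?_ hψs.mul_right
    exact hψ.continuous.mul (((hωv j).continuous_fderiv (by simp)).clm_apply continuous_const)
  have hi2 : ∀ j, Integrable (fun x => fderiv ℝ ψ x (v j) * ω x (j.removeNth v)) := by
    intro j
    refine Continuous.integrable_of_hasCompactSupport ?_ (hωs j).mul_left
    exact ((hψ.continuous_fderiv (by simp)).clm_apply continuous_const).mul (hωv j).continuous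
  have hi3 : ∀ j : Fin (m + 1), Integrable (fun x => ψ x * ω x (j.removeNth v)) := by
    intro j
    exact Continuous.integrable_of_hasCompactSupport (hψ.continuous.mul (hωv j).continuous)
      hψs.mul_right
  have hexp : ∀ x, ψ x * formCoeff (extDeriv ω x) I =
      ∑ j : Fin (m + 1), (-1 : ℂ) ^ (j : ℕ) *
        (ψ x * fderiv ℝ (fun x => ω x (j.removeNth v)) x (v j)) := by
    intro x
    rw [formCoeff_apply _ h, extDeriv_apply (hω.differentiable (by simp) x) v, Finset.mul_sum]
    refine Finset.sum_congr rfl fun j _ => ?_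
    rcases neg_one_pow_eq_or ℤ (j : ℕ) with hj | hj
    · have hj' : (-1 : ℂ) ^ (j : ℕ) = 1 := by exact_mod_cast congrArg (Int.cast : ℤ → ℂ) hj
      rw [hj, hj', one_smul, one_mul]
    · have hj' : (-1 : ℂ) ^ (j : ℕ) = -1 := by exact_mod_cast congrArg (Int.cast : ℤ → ℂ) hj
      rw [hj, hj', neg_smul, one_smul]
      ring
  simp only [hexp, hv]
  rw [integral_finsetSum _ fun j _ => (hi1 j).const_mul _]
  refine Finset.sum_congr rfl fun j _ => ?_
  rw [integral_const_mul, integral_mul_fderiv_eq_neg_fderiv_mul_of_integrable (hi2 j) (hi1 j)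
    (hi3 j) (fun x _ => hψd x) (fun x _ => hωd j x)]
  ring

/-- The formal adjoint of the exterior derivative, on the test forms `conj ψ dx_I`. -/
theorem exists_formal_adjoint {ψ : Rn q → ℂ} (hψ : ContDiff ℝ (⊤ : ℕ∞) ψ)
    (hψs : HasCompactSupport ψ) (I : Finset (Fin q)) :
    ∃ g : FormSpace q, ∀ p ∈ testGraph q,
      ⟪(memLp_coordFn hψ.continuous hψs I).toLp, p.2⟫_ℂ = ⟪g, p.1⟫_ℂ := by
  have key : ∀ g : FormSpace q, (∀ (p : FormSpace q × FormSpace q) (k : ℕ) (ω : Rn q → AltForm q k),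
      ContDiff ℝ (⊤ : ℕ∞) ω → HasCompactSupport ω →
      (p.1 : Rn q → FormFibre q) =ᵐ[volume] (fun x => formCoeff (ω x)) →
      ∫ x, ψ x * formCoeff (extDeriv ω x) I = ⟪g, p.1⟫_ℂ) →
      ∀ p ∈ testGraph q, ⟪(memLp_coordFn hψ.continuous hψs I).toLp, p.2⟫_ℂ = ⟪g, p.1⟫_ℂ := by
    intro g hg p hp
    induction hp using Submodule.span_induction with
    | mem p hp =>
      obtain ⟨k, ω, hω, hs, h1, h2⟩ := hp
      rw [← hg p k ω hω hs h1, inner_coordFn]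
      refine integral_congr_ae ?_
      filter_upwards [h2] with x hx
      rw [hx]
    | zero => simp
    | add p p' _ _ h h' => rw [Prod.snd_add, Prod.fst_add, inner_add_right, inner_add_right, h, h']
    | smul c p _ h => rw [Prod.smul_snd, Prod.smul_fst, inner_smul_right, inner_smul_right, h]
  -- No dω has a component of degree 0, so the formal adjoint vanishes there. For |I| = m + 1 only
  -- forms of degree m contribute.
  rcases hI : I.card with _ | m
  · refine ⟨0, key 0 fun p k ω _ _ _ => ?_⟩
    have : ∀ x, formCoeff (extDeriv ω x) I = 0 := fun x =>
      formCoeff_apply_of_ne _ (by omega)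
    simp [this]
  · let v : Fin (m + 1) → Rn q := fun i => EuclideanSpace.single (I.orderEmbOfFin hI i) (1 : ℝ)
    have hc : ∀ j, Continuous fun x => fderiv ℝ ψ x (v j) := fun j =>
      (hψ.continuous_fderiv (by simp)).clm_apply continuous_const
    have hcs : ∀ j, HasCompactSupport fun x => fderiv ℝ ψ x (v j) := fun j =>
      hψs.fderiv_apply ℝ (v j)
    refine ⟨∑ j : Fin (m + 1), (-(-1 : ℂ) ^ (j : ℕ)) •
      (memLp_coordFn (hc j) (hcs j) (I.erase (I.orderEmbOfFin hI j))).toLp, key _ ?_⟩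
    intro p k ω hω hs h1
    have h2 : ∀ j, ⟪(memLp_coordFn (hc j) (hcs j) (I.erase (I.orderEmbOfFin hI j))).toLp, p.1⟫_ℂ =
        ∫ x, fderiv ℝ ψ x (v j) * formCoeff (ω x) (I.erase (I.orderEmbOfFin hI j)) := by
      intro j
      rw [inner_coordFn]
      refine integral_congr_ae ?_
      filter_upwards [h1] with x hx
      rw [hx]
    rw [sum_inner]
    simp only [inner_smul_left, h2, map_neg, map_pow, map_one]
    by_cases hk : k = m
    · subst hk
      exact integral_mul_coeff_extDeriv hω hs hψ hψs hI
    · have h3 : ∀ x, formCoeff (extDeriv ω x) I = 0 := fun x =>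
        formCoeff_apply_of_ne _ (by omega)
      have h4 : ∀ x j, formCoeff (ω x) (I.erase (I.orderEmbOfFin hI j)) = 0 := fun x j =>
        formCoeff_apply_of_ne _ (by rw [card_erase_orderEmbOfFin hI j]; exact fun h => hk h.symm)
      simp [h3, h4]

/-- The exterior derivative on test forms is closable. -/
theorem closure_testGraph_functional :
    ∀ p ∈ (testGraph q).topologicalClosure, p.1 = 0 → p.2 = 0 := by
  intro p hp h0
  refine eq_zero_of_integral_coord_eq_zero fun I ψ hψ hs => ?_
  have hψ' : ContDiff ℝ (⊤ : ℕ∞) fun x => (ψ x : ℂ) := Complex.ofRealCLM.contDiff.comp hψ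
  have hs' : HasCompactSupport fun x => (ψ x : ℂ) :=
    hs.comp_left (g := fun t : ℝ => (t : ℂ)) (by simp)
  obtain ⟨g, hg⟩ := exists_formal_adjoint hψ' hs' I
  -- The adjoint relation is a closed condition on pairs, so it survives on the closure; a pair (0,
  -- y) is then orthogonal to all test forms.
  have hcl : IsClosed {p : FormSpace q × FormSpace q |
      ⟪(memLp_coordFn hψ'.continuous hs' I).toLp, p.2⟫_ℂ = ⟪g, p.1⟫_ℂ} :=
    isClosed_eq (by fun_prop) (by fun_prop)
  have h := closure_minimal (s := (testGraph q : Set (FormSpace q × FormSpace q))) hg hcl hp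
  change ⟪(memLp_coordFn hψ'.continuous hs' I).toLp, p.2⟫_ℂ = ⟪g, p.1⟫_ℂ at h
  rw [h0, inner_zero_right, inner_coordFn] at h
  exact h

/-- Closability is what makes the closed submodule single valued, hence the graph of the operator
defined from it. -/
theorem graph_extD : (extD q).graph = (testGraph q).topologicalClosure :=
  Submodule.toLinearPMap_graph_eq _ closure_testGraph_functional

theorem isClosed_extD : (extD q).IsClosed := by
  rw [LinearPMap.IsClosed, graph_extD]
  exact Submodule.isClosed_topologicalClosure _

/-- The exterior derivative is a differential. -/
theorem extD_extD (x y : FormSpace q) (h : (x, y) ∈ (extD q).graph) :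
    (y, (0 : FormSpace q)) ∈ (extD q).graph := by
  rw [graph_extD] at h ⊢
  -- The continuous map (x, y) ↦ (y, 0) preserves the test graph because ddω = 0, hence it preserves
  -- the closure.
  let T : FormSpace q × FormSpace q →L[ℂ] FormSpace q × FormSpace q :=
    (ContinuousLinearMap.snd ℂ _ _).prod 0
  have hT : Set.MapsTo T (testGraph q) (testGraph q) := by
    intro p hp
    change T p ∈ testGraph q
    induction hp using Submodule.span_induction with
    | mem p hp =>
      obtain ⟨k, ω, hω, hs, h1, h2⟩ := hp
      refine Submodule.subset_span ⟨k + 1, extDeriv ω, contDiff_extDeriv hω,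
        hasCompactSupport_extDeriv hs, h2, ?_⟩
      rw [extDeriv_extDeriv hω (by
        rw [minSmoothness_of_isRCLikeNormedField]
        exact WithTop.coe_le_coe.2 (le_top : (2 : ℕ∞) ≤ ⊤))]
      filter_upwards [Lp.coeFn_zero (FormFibre q) 2 (volume : Measure (Rn q))] with x hx
      exact hx.trans (formCoeff_zero _).symm
    | zero => rw [map_zero]; exact zero_mem _
    | add p p' _ _ h h' => rw [map_add]; exact add_mem h h'
    | smul c p _ h => rw [map_smul]; exact Submodule.smul_mem _ c h
  have h' := map_mem_closure T.continuous h hT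
  exact h'

/-- The alternating form `dx_I`. -/
def basisForm (I : Finset (Fin q)) : AltForm q I.card :=
  let α : Rn q [⋀^Fin I.card]→ₗ[ℝ] ℂ :=
    Complex.ofRealCLM.toLinearMap.compAlternatingMap
      ((Matrix.detRowAlternating (R := ℝ) (n := Fin I.card)).compLinearMap
        (LinearMap.pi fun b => (EuclideanSpace.proj (𝕜 := ℝ) (I.orderEmbOfFin rfl b)).toLinearMap))
  { α with
    cont := by
      change Continuous fun v : Fin I.card → Rn q =>
        ((Matrix.det (Matrix.of fun a b => v a (I.orderEmbOfFin rfl b)) : ℝ) : ℂ)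
      refine Complex.continuous_ofReal.comp (Continuous.matrix_det ?_)
      fun_prop }

theorem basisForm_apply (I : Finset (Fin q)) (v : Fin I.card → Rn q) :
    basisForm I v = ((Matrix.det (Matrix.of fun a b => v a (I.orderEmbOfFin rfl b)) : ℝ) : ℂ) := rfl

/-- At J = I the matrix is the identity. Any other J of the same size has an element outside I,
which produces a zero row. -/
theorem formCoeff_smul_basisForm (c : ℝ) (I : Finset (Fin q)) :
    formCoeff (c • basisForm I) = EuclideanSpace.single I (c : ℂ) := by
  ext J
  by_cases hJ : J.card = I.card
  · rw [formCoeff_apply _ hJ, ContinuousAlternatingMap.smul_apply, basisForm_apply,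
      PiLp.single_apply]
    split_ifs with h
    · subst h
      have : (Matrix.of fun a b => (EuclideanSpace.single (J.orderEmbOfFin hJ a) (1 : ℝ) : Rn q)
          (J.orderEmbOfFin rfl b)) = (1 : Matrix (Fin J.card) (Fin J.card) ℝ) := by
        ext a b
        simp [Matrix.one_apply, eq_comm]
      rw [this]
      simp
    · have hsub : ¬ J ⊆ I := fun hsub => h (Finset.eq_of_subset_of_card_le hsub hJ.ge)
      obtain ⟨i, hiJ, hiI⟩ := Finset.not_subset.1 hsub
      obtain ⟨a, ha⟩ : ∃ a, J.orderEmbOfFin hJ a = i := by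
        have : i ∈ Set.range (J.orderEmbOfFin hJ) := by
          rw [Finset.range_orderEmbOfFin]
          exact hiJ
        exact this
      rw [Matrix.det_eq_zero_of_row_eq_zero a]
      · simp
      · intro b
        have : I.orderEmbOfFin rfl b ≠ i := fun e => hiI (e ▸ Finset.orderEmbOfFin_mem I rfl b)
        simp [ha, this]
  · rw [formCoeff_apply_of_ne _ hJ, PiLp.single_apply, if_neg]
    rintro rfl
    exact hJ rfl

theorem mem_domain_extD_of_ae_eq {k : ℕ} {ω : Rn q → AltForm q k}
    (hω : ContDiff ℝ (⊤ : ℕ∞) ω) (hs : HasCompactSupport ω) {y : FormSpace q}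
    (hy : (y : Rn q → FormFibre q) =ᵐ[volume] fun x => formCoeff (ω x)) :
    y ∈ (extD q).domain := by
  have hd := memLp_formCoeff (contDiff_extDeriv hω).continuous (hasCompactSupport_extDeriv hs)
  have hmem : (y, hd.toLp) ∈ testGraph q :=
    Submodule.subset_span ⟨k, ω, hω, hs, hy, hd.coeFn_toLp⟩
  have hmem' : (y, hd.toLp) ∈ (extD q).graph := by
    rw [graph_extD]
    exact Submodule.le_topologicalClosure _ hmem
  exact LinearPMap.mem_domain_of_mem_graph hmem'

theorem coordFn_mem_domain {ψ : Rn q → ℝ} (hψ : ContDiff ℝ (⊤ : ℕ∞) ψ) (hs : HasCompactSupport ψ)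
    (I : Finset (Fin q))
    (hm : MemLp (coordFn (fun x => (ψ x : ℂ)) I) 2 (volume : Measure (Rn q))) :
    hm.toLp ∈ (extD q).domain := by
  have hω : ContDiff ℝ (⊤ : ℕ∞) fun x => ψ x • basisForm I := hψ.smul contDiff_const
  have hωs : HasCompactSupport fun x => ψ x • basisForm I :=
    hs.comp_left (g := fun t : ℝ => t • basisForm I) (zero_smul ℝ (basisForm I))
  refine mem_domain_extD_of_ae_eq hω hωs ?_
  filter_upwards [hm.coeFn_toLp] with x hx
  rw [formCoeff_smul_basisForm, hx, coordFn, Complex.conj_ofReal]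

/-- The forms ψ dx_I with ψ a real test function lie in the domain, and only 0 is orthogonal to all
of them. -/
theorem dense_domain_extD : Dense ((extD q).domain : Set (FormSpace q)) := by
  rw [Submodule.dense_iff_topologicalClosure_eq_top, Submodule.topologicalClosure_eq_top_iff,
    Submodule.eq_bot_iff]
  intro y hy
  refine eq_zero_of_integral_coord_eq_zero fun I ψ hψ hs => ?_
  have hψ' : ContDiff ℝ (⊤ : ℕ∞) fun x => (ψ x : ℂ) := Complex.ofRealCLM.contDiff.comp hψ
  have hs' : HasCompactSupport fun x => (ψ x : ℂ) :=
    hs.comp_left (g := fun t : ℝ => (t : ℂ)) (by simp)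
  have hm := memLp_coordFn hψ'.continuous hs' I
  have h := (Submodule.mem_orthogonal _ _).1 hy hm.toLp (coordFn_mem_domain hψ hs I hm)
  rw [inner_coordFn] at h
  exact h

end ExteriorDerivative

/-! ### Curves defined by the functional calculus -/

section Curves

namespace SpectralRep

variable {𝒜 X H : Type*} [AddCommGroup 𝒜] [Module ℂ 𝒜] [MeasurableSpace X]
  [NormedAddCommGroup H] [InnerProductSpace ℂ H] [CompleteSpace H] {S : SpectralRep 𝒜 X H}

/-- Dominated convergence for `g ↦ g(A) x`. -/
theorem tendsto_vec_of_dominated {ι : Type*} {l : Filter ι} [l.IsCountablyGenerated] {x : H}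
    {G : ι → X → ℂ} {g : X → ℂ} {b : X → ℂ} (hb : MemLp b 2 (S.meas x))
    (hG : ∀ i, Measurable (G i)) (hg : Measurable g) (hGb : ∀ i s, ‖G i s‖ ≤ ‖b s‖)
    (hgb : ∀ s, ‖g s‖ ≤ ‖b s‖) (hl : ∀ s, Tendsto (fun i => G i s) l (𝓝 (g s))) :
    Tendsto (fun i => S.vec x (G i)) l (𝓝 (S.vec x g)) := by
  refine tendsto_vec (fun i => hb.mono (hG i).aestronglyMeasurable (.of_forall (hGb i)))
    (hb.mono hg.aestronglyMeasurable (.of_forall hgb)) ?_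
  have hsq : Tendsto (fun i => ∫⁻ s, ‖(G i - g) s‖ₑ ^ 2 ∂(S.meas x)) l
      (𝓝 (∫⁻ _, 0 ∂(S.meas x))) := by
    refine tendsto_lintegral_filter_of_dominated_convergence
      (fun s => ‖((2 : ℂ) • b) s‖ₑ ^ 2) ?_ ?_ ?_ ?_
    · exact .of_forall fun i => ((hG i).sub hg).enorm.pow_const 2
    · refine .of_forall fun i => .of_forall fun s => ?_
      have h : ‖(G i - g) s‖ ≤ ‖((2 : ℂ) • b) s‖ := by
        rw [Pi.sub_apply, Pi.smul_apply, norm_smul, Complex.norm_two]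
        linarith [norm_sub_le (G i s) (g s), hGb i s, hgb s]
      gcongr
      exact enorm_le_iff_norm_le.2 h
    · rw [← eLpNorm_two_sq]
      exact ENNReal.pow_ne_top (hb.const_smul (2 : ℂ)).2.ne
    · refine .of_forall fun s => ?_
      have h : Tendsto (fun i => G i s - g s) l (𝓝 0) := by
        simpa using (hl s).sub_const (g s)
      have h2 := (ENNReal.continuous_pow 2).tendsto 0 |>.comp
        (by simpa using (continuous_enorm.tendsto (0 : ℂ)).comp h)
      simpa [Function.comp_def] using h2
  simp only [lintegral_zero] at hsq
  have hpow := (ENNReal.continuous_rpow_const (y := (1 / 2 : ℝ))).tendsto 0 |>.comp hsq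
  rw [ENNReal.zero_rpow_of_pos (by norm_num)] at hpow
  refine hpow.congr fun i => ?_
  rw [Function.comp_apply, ← eLpNorm_two_sq, ← ENNReal.rpow_natCast, ← ENNReal.rpow_mul]
  norm_num

variable [NormedSpace ℝ H] [IsScalarTower ℝ ℂ H]

/-- Differentiation of `t ↦ G_t(A) x` under the functional calculus. -/
theorem hasDerivAt_vec {x : H} {G : ℝ → X → ℂ} {g b : X → ℂ} {t₀ : ℝ}
    (hb : MemLp b 2 (S.meas x)) (hG : ∀ t, Measurable (G t)) (hGm : ∀ t, MemLp (G t) 2 (S.meas x))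
    (hg : Measurable g) (hd : ∀ s, HasDerivAt (fun t => G t s) (g s) t₀)
    (hlip : ∀ t s, ‖G t s - G t₀ s‖ ≤ ‖b s‖ * |t - t₀|) :
    HasDerivAt (fun t => S.vec x (G t)) (S.vec x g) t₀ := by
  rw [hasDerivAt_iff_tendsto_slope]
  have hslope : ∀ t, slope (fun t => S.vec x (G t)) t₀ t =
      S.vec x (((t - t₀)⁻¹ : ℂ) • (G t - G t₀)) := by
    intro t
    rw [vec_const_smul _ ((hGm t).sub (hGm t₀)), vec_sub (hGm t) (hGm t₀), slope_def_module,
      ← algebraMap_smul ℂ (t - t₀)⁻¹]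
    simp
  have hpt : ∀ s, Tendsto (fun t : ℝ => (((t - t₀)⁻¹ : ℂ) • (G t - G t₀)) s) (𝓝[≠] t₀)
      (𝓝 (g s)) := by
    intro s
    have h := hasDerivAt_iff_tendsto_slope.1 (hd s)
    refine h.congr fun t => ?_
    rw [slope_def_module, Complex.real_smul]
    push_cast
    rfl
  have hbd : ∀ (t : ℝ) s, ‖(((t - t₀)⁻¹ : ℂ) • (G t - G t₀)) s‖ ≤ ‖b s‖ := by
    intro t s
    rw [Pi.smul_apply, Pi.sub_apply, norm_smul, norm_inv, ← Complex.ofReal_sub, Complex.norm_real,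
      Real.norm_eq_abs]
    -- At t = t₀ the inverse is 0 by convention, so the bound holds for every t.
    rcases eq_or_ne t t₀ with rfl | ht
    · simp
    · rw [inv_mul_le_iff₀ (abs_pos.2 (sub_ne_zero.2 ht)), mul_comm]
      exact hlip t s
  simp only [funext hslope]
  exact tendsto_vec_of_dominated hb (fun t => ((hG t).sub (hG t₀)).const_smul _) hg hbd
    (fun s => le_of_tendsto (hpt s).norm (.of_forall fun t => hbd t s)) hpt

end SpectralRep

variable {H : Type*} [NormedAddCommGroup H] [InnerProductSpace ℂ H] [CompleteSpace H]
  [NormedSpace ℝ H] [IsScalarTower ℝ ℂ H]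

/-- The curve `w(t) = φ(t A) v` solves `t w'' + (n - 1) w' + t A² w = 0` for `v` in the domain
of `A²`. -/
theorem bessel_curve {A : H →ₗ.[ℂ] H} {E : PVM H} (hE : E.IsResolutionOf A)
    (hA : Dense (A.domain : Set H)) {n : ℕ} (hn : 1 ≤ n) {φ : ℝ → ℝ} (hφ : IsBesselSolution n φ)
    {v v₁ v₂ : H} (hv₁ : (v, v₁) ∈ A.graph) (hv₂ : (v₁, v₂) ∈ A.graph) :
    ∃ w₁ w₂ z : ℝ → H,
      (∀ t, HasDerivAt (fun t => E.integral (fun s => φ (t * s)) v) (w₁ t) t) ∧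
      (∀ t, HasDerivAt w₁ (w₂ t) t) ∧
      E.integral (fun s => φ (0 * s)) v = v ∧ w₁ 0 = 0 ∧
      (∀ t, ∃ u, (E.integral (fun s => φ (t * s)) v, u) ∈ A.graph ∧ (u, z t) ∈ A.graph) ∧
      ∀ t, t • w₂ t + ((n : ℝ) - 1) • w₁ t + t • z t = 0 := by
  obtain ⟨C, hC⟩ := hφ.exists_abs_deriv_deriv_le hn
  have hid : Measurable fun s : ℝ => (s : ℂ) := Complex.measurable_ofReal
  have hm1 : MemLp (fun s : ℝ => (s : ℂ)) 2 (E.rep.meas v) :=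
    hE.mem_domain_iff.1 (LinearPMap.mem_domain_of_mem_graph hv₁)
  -- Membership of v in the domain of A² means that s² is square integrable for its spectral
  -- measure.
  have hm2 : MemLp (fun s : ℝ => (s : ℂ) * s) 2 (E.rep.meas v) := by
    obtain ⟨y, hy, hy'⟩ := (LinearPMap.mem_graph_iff _).1 hv₁
    have h1 : v₁ = E.rep.vec v fun s => (s : ℂ) := by
      rw [show v₁ = A y from hy'.symm, hE.apply_eq hA, hy]
    rw [← hE.vec_mem_domain_iff hid hm1, ← h1]
    exact LinearPMap.mem_domain_of_mem_graph hv₂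
  have c0 : Continuous φ := hφ.contDiff.continuous
  have c1 : Continuous (deriv φ) := hφ.contDiff_deriv.continuous
  have c2 : Continuous (deriv (deriv φ)) := hφ.continuous_deriv_deriv
  -- G₀, G₁, G₂ are the symbols of the curve and of its first two t-derivatives; L₁, L₂ are those of
  -- A and A² applied to the curve.
  let G₀ : ℝ → ℝ → ℂ := fun t s => (φ (t * s) : ℂ)
  let G₁ : ℝ → ℝ → ℂ := fun t s => (s * deriv φ (t * s) : ℝ)
  let G₂ : ℝ → ℝ → ℂ := fun t s => (s * (s * deriv (deriv φ) (t * s)) : ℝ)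
  let L₁ : ℝ → ℝ → ℂ := fun t s => (s : ℂ) * G₀ t s
  let L₂ : ℝ → ℝ → ℂ := fun t s => (s : ℂ) * L₁ t s
  have hG₀ : ∀ t, Measurable (G₀ t) := fun t => Continuous.measurable (by fun_prop)
  have hG₁ : ∀ t, Measurable (G₁ t) := fun t => Continuous.measurable (by fun_prop)
  have hG₂ : ∀ t, Measurable (G₂ t) := fun t => Continuous.measurable (by fun_prop)
  have hL₁ : ∀ t, Measurable (L₁ t) := fun t => hid.mul (hG₀ t)
  have hL₂ : ∀ t, Measurable (L₂ t) := fun t => hid.mul (hL₁ t)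
  have mG₀ : ∀ t, MemLp (G₀ t) 2 (E.rep.meas v) := fun t =>
    memLp_of_bounded (C := 1) (hG₀ t) (fun s => by simpa [G₀] using hφ.abs_le_one hn (t * s)) _
  have mG₁ : ∀ t, MemLp (G₁ t) 2 (E.rep.meas v) := fun t =>
    hm1.mono (hG₁ t).aestronglyMeasurable (.of_forall fun s => by
      simp only [G₁, Complex.norm_real, Real.norm_eq_abs, abs_mul]
      exact mul_le_of_le_one_right (abs_nonneg s) (hφ.abs_deriv_le_one hn _))
  have hmC : MemLp ((C : ℂ) • fun s : ℝ => (s : ℂ) * s) 2 (E.rep.meas v) := hm2.const_smul _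
  have hC0 : 0 ≤ C := (abs_nonneg _).trans (hC 0)
  have mG₂ : ∀ t, MemLp (G₂ t) 2 (E.rep.meas v) := fun t =>
    hmC.mono (hG₂ t).aestronglyMeasurable (.of_forall fun s => by
      simp only [G₂, Pi.smul_apply, smul_eq_mul, norm_mul, Complex.norm_real, Real.norm_eq_abs,
        abs_of_nonneg hC0]
      nlinarith [mul_le_mul_of_nonneg_left (hC (t * s)) (mul_nonneg (abs_nonneg s) (abs_nonneg s))])
  have mL₁ : ∀ t, MemLp (L₁ t) 2 (E.rep.meas v) := fun t =>
    hm1.mono (hL₁ t).aestronglyMeasurable (.of_forall fun s => by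
      simp only [L₁, G₀, norm_mul, Complex.norm_real, Real.norm_eq_abs]
      exact mul_le_of_le_one_right (abs_nonneg s) (hφ.abs_le_one hn _))
  have mL₂ : ∀ t, MemLp (L₂ t) 2 (E.rep.meas v) := fun t =>
    hm2.mono (hL₂ t).aestronglyMeasurable (.of_forall fun s => by
      simp only [L₂, L₁, G₀, norm_mul, Complex.norm_real, Real.norm_eq_abs]
      gcongr
      exact mul_le_of_le_one_right (abs_nonneg s) (hφ.abs_le_one hn _))
  have hw : ∀ t, E.integral (fun s => φ (t * s)) v = E.rep.vec v (G₀ t) := fun t =>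
    E.integral_apply (Continuous.measurable (by fun_prop)) (fun s => hφ.abs_le_one hn (t * s)) v
  have hlin : ∀ s t : ℝ, HasDerivAt (fun t : ℝ => t * s) s t := fun s t => by
    simpa using (hasDerivAt_id t).mul_const s
  have lip : ∀ (h : ℝ → ℝ) (K : ℝ), Differentiable ℝ h → (∀ r, |deriv h r| ≤ K) →
      ∀ a b, |h a - h b| ≤ K * |a - b| := fun h K hd hK a b =>
    Convex.norm_image_sub_le_of_norm_deriv_le (s := Set.univ) (fun r _ => hd r)
      (fun r _ => hK r) convex_univ (Set.mem_univ b) (Set.mem_univ a)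
  refine ⟨fun t => E.rep.vec v (G₁ t), fun t => E.rep.vec v (G₂ t), fun t => E.rep.vec v (L₂ t),
    fun t => ?_, fun t => ?_, ?_, ?_, fun t => ?_, fun t => ?_⟩
  · simp only [hw]
    refine SpectralRep.hasDerivAt_vec hm1 hG₀ mG₀ (hG₁ t) (fun s => ?_) fun t' s => ?_
    · refine (((hφ.differentiable (t * s)).hasDerivAt.comp t (hlin s t)).congr_deriv ?_).ofReal_comp
      ring
    · simp only [G₀]
      rw [← Complex.ofReal_sub, Complex.norm_real, Complex.norm_real, Real.norm_eq_abs,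
        Real.norm_eq_abs, ← abs_mul]
      refine (lip φ 1 hφ.differentiable (hφ.abs_deriv_le_one hn) _ _).trans_eq ?_
      rw [one_mul]
      ring_nf
  · refine SpectralRep.hasDerivAt_vec hmC hG₁ mG₁ (hG₂ t) (fun s => ?_) fun t' s => ?_
    · refine ((((hφ.differentiable_deriv (t * s)).hasDerivAt.comp t (hlin s t)).const_mul
        s).congr_deriv ?_).ofReal_comp
      ring
    · simp only [G₁]
      rw [← Complex.ofReal_sub, Complex.norm_real, Real.norm_eq_abs, ← mul_sub, abs_mul]
      have h1 := lip (deriv φ) C hφ.differentiable_deriv hC (t' * s) (t * s)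
      have h2 : |t' * s - t * s| = |s| * |t' - t| := by
        rw [← sub_mul, abs_mul, mul_comm]
      rw [h2] at h1
      refine (mul_le_mul_of_nonneg_left h1 (abs_nonneg s)).trans_eq ?_
      simp only [Pi.smul_apply, smul_eq_mul, norm_mul, Complex.norm_real, Real.norm_eq_abs,
        abs_of_nonneg hC0]
      ring
  · have h1 : G₀ 0 = 1 := by
      ext s
      simp [G₀, hφ.init]
    rw [hw, h1, SpectralRep.vec_one]
  · have h1 : G₁ 0 = 0 := by
      ext s
      simp [G₁, hφ.init_deriv]
    simp only [h1, SpectralRep.vec_zero]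
  · have d1 := (hE.vec_mem_domain_iff (hG₀ t) (mG₀ t)).2 (mL₁ t)
    have d2 := (hE.vec_mem_domain_iff (hL₁ t) (mL₁ t)).2 (mL₂ t)
    refine ⟨E.rep.vec v (L₁ t), ?_, ?_⟩
    · rw [hw]
      exact (LinearPMap.mem_graph_iff _).2 ⟨⟨_, d1⟩, rfl, hE.apply_vec hA (hG₀ t) (mG₀ t) d1⟩
    · exact (LinearPMap.mem_graph_iff _).2 ⟨⟨_, d2⟩, rfl, hE.apply_vec hA (hL₁ t) (mL₁ t) d2⟩
  · have h0 : (t : ℂ) • G₂ t + (((n : ℝ) - 1 : ℝ) : ℂ) • G₁ t + (t : ℂ) • L₂ t = 0 := by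
      ext s
      simp only [Pi.add_apply, Pi.smul_apply, smul_eq_mul, G₂, G₁, L₂, L₁, G₀, Pi.zero_apply]
      rw [← Complex.ofReal_mul s (φ _), ← Complex.ofReal_mul s, ← Complex.ofReal_mul t,
        ← Complex.ofReal_mul t, ← Complex.ofReal_mul, ← Complex.ofReal_add, ← Complex.ofReal_add,
        Complex.ofReal_eq_zero]
      rcases eq_or_ne (t * s) 0 with hts | hts
      · rcases mul_eq_zero.1 hts with h | h
        · simp [h, hφ.init_deriv]
        · simp [h]
      · have h := hφ.ode (t * s) hts
        have ht : t ≠ 0 := left_ne_zero_of_mul hts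
        have hs : s ≠ 0 := right_ne_zero_of_mul hts
        field_simp at h
        linear_combination s * h
    have h1 := congrArg (E.rep.vec v) h0
    rw [SpectralRep.vec_zero, SpectralRep.vec_add
      (((mG₂ t).const_smul _).add ((mG₁ t).const_smul _)) ((mL₂ t).const_smul _),
      SpectralRep.vec_add ((mG₂ t).const_smul _) ((mG₁ t).const_smul _),
      SpectralRep.vec_const_smul _ (mG₂ t), SpectralRep.vec_const_smul _ (mG₁ t),
      SpectralRep.vec_const_smul _ (mL₂ t), ← Complex.coe_algebraMap,
      algebraMap_smul, algebraMap_smul, algebraMap_smul] at h1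
    exact h1

end Curves

theorem exists_hodgeLaplacian_eq_of_mem_graph {q : ℕ} {x y : FormSpace q}
    (h : (x, y) ∈ (hodgeLaplacian q).graph) :
    ∃ hx : x ∈ (hodgeLaplacian q).domain, hodgeLaplacian q ⟨x, hx⟩ = y := by
  obtain ⟨z, rfl, hz⟩ := (LinearPMap.mem_graph_iff _).1 h
  exact ⟨z.2, hz⟩

/-- The curves `φ_n(t D) v`, for `v` in the domain of the Hodge Laplacian. -/
theorem phiDirac_curve {q n : ℕ} (hn : 1 ≤ n) {v : FormSpace q}
    (hv : v ∈ (hodgeLaplacian q).domain) :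
    ∃ w₁ w₂ z : ℝ → FormSpace q,
      (∀ t, HasDerivAt (fun t => phiDirac q n t v) (w₁ t) t) ∧
      (∀ t, HasDerivAt w₁ (w₂ t) t) ∧ phiDirac q n 0 v = v ∧ w₁ 0 = 0 ∧
      (∀ t, (phiDirac q n t v, z t) ∈ (hodgeLaplacian q).graph) ∧
      ∀ t, t • w₂ t + ((n : ℝ) - 1) • w₁ t + t • z t = 0 := by
  have hd := dense_domain_extD (q := q)
  have hL : ∀ {x y : FormSpace q}, (x, y) ∈ (hodgeLaplacian q).graph ↔
      ∃ u, (x, u) ∈ (dirac q).graph ∧ (u, y) ∈ (dirac q).graph :=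
    mem_graph_laplacian_iff hd extD_extD
  obtain ⟨E, hE, hEg⟩ := funCalc_eq (exists_resolution_dirac isClosed_extD hd extD_extD)
  obtain ⟨u, hu, hu'⟩ := hL.1 ((hodgeLaplacian q).mem_graph ⟨v, hv⟩)
  have hphi : ∀ t, phiDirac q n t = E.integral fun s => besselPhi n (t * s) := fun t => hEg _
  obtain ⟨w₁, w₂, z, h1, h2, h3, h4, h5, h6⟩ := bessel_curve hE
    (dense_domain_dirac isClosed_extD hd extD_extD) hn (isBesselSolution_besselPhi hn) hu hu'
  refine ⟨w₁, w₂, z, ?_, h2, ?_, h4, ?_, h6⟩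
  · simpa only [hphi] using h1
  · rw [hphi]
    exact h3
  · intro t
    rw [hphi]
    exact hL.2 (h5 t)

end

theorem theorem1 (q : ℕ) (hq : 1 ≤ q) (f : (extD q).domain)
    (hf : extD q f ∈ (hodgeLaplacian q).domain) :
    (SolvesWave q (besselAccelOne q) (fun t => deformedExtD q t f) ∧
      deformedExtD q 0 f = 0 ∧
      HasDerivAt (fun t => deformedExtD q t f) (extD q f) 0 ∧
      Tendsto (deriv fun t => deformedExtD q t f) (𝓝[≠] 0) (𝓝 (extD q f))) ∧
    (SolvesWave q (besselAccelZero q) (fun t => phiDirac q q t (extD q f)) ∧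
      phiDirac q q 0 (extD q f) = extD q f ∧
      HasDerivAt (fun t => phiDirac q q t (extD q f)) 0 0 ∧
      Tendsto (deriv fun t => phiDirac q q t (extD q f)) (𝓝[≠] 0) (𝓝 0)) := by
  constructor
  · obtain ⟨w₁, w₂, z, h1, h2, h3, h4, h5, h6⟩ := phiDirac_curve (n := q + 2) (by omega) hf
    have hu : (fun t => deformedExtD q t f) = fun t : ℝ => t • phiDirac q (q + 2) t (extD q f) :=
      rfl
    have hu' : ∀ t : ℝ, HasDerivAt (fun t => deformedExtD q t f)
        (t • w₁ t + phiDirac q (q + 2) t (extD q f)) t := by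
      intro t
      rw [hu]
      refine ((hasDerivAt_id t).smul (h1 t)).congr_deriv ?_
      rw [one_smul]
      rfl
    have hd : deriv (fun t => deformedExtD q t f) =
        fun t => t • w₁ t + phiDirac q (q + 2) t (extD q f) := funext fun t => (hu' t).deriv
    have hu'' : ∀ t : ℝ, HasDerivAt (deriv fun t => deformedExtD q t f)
        (t • w₂ t + w₁ t + w₁ t) t := by
      intro t
      rw [hd]
      refine (((hasDerivAt_id t).smul (h2 t)).add (h1 t)).congr_deriv ?_
      rw [one_smul]
      rfl
    have e0 : (0 : ℝ) • w₁ 0 + phiDirac q (q + 2) 0 (extD q f) = extD q f := by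
      rw [zero_smul, zero_add, h3]
    refine ⟨fun t ht => ⟨(hu' t).differentiableAt, (hu'' t).differentiableAt, ?_⟩, ?_, ?_, ?_⟩
    · have hg : (deformedExtD q t f, t • z t) ∈ (hodgeLaplacian q).graph := by
        have := Submodule.smul_mem _ (t : ℂ) (h5 t)
        rw [Prod.smul_mk, Complex.coe_smul, Complex.coe_smul] at this
        exact this
      obtain ⟨hx, hLx⟩ := exists_hodgeLaplacian_eq_of_mem_graph hg
      refine ⟨hx, ?_⟩
      rw [hLx, besselAccelOne, (hu'' t).deriv, (hu' t).deriv]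
      change _ + ((q : ℝ) - 1) • (_ - (1 / t ^ 2) • (t • phiDirac q (q + 2) t (extD q f))) + _ = _
      -- With u = tw the terms (q-1)w/t cancel. What remains is t w'' + (2 + (q-1))w' + tLw, the
      -- curve equation for n = q + 2.
      rw [← h6 t]
      push_cast
      match_scalars <;> field_simp <;> ring
    · exact zero_smul ℝ _
    · exact (hu' 0).congr_deriv e0
    · have h := (hu'' 0).continuousAt.tendsto
      rw [(hu' 0).deriv, e0] at h
      exact h.mono_left nhdsWithin_le_nhds
  · obtain ⟨w₁, w₂, z, h1, h2, h3, h4, h5, h6⟩ := phiDirac_curve hq hf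
    have hd : deriv (fun t => phiDirac q q t (extD q f)) = w₁ := funext fun t => (h1 t).deriv
    refine ⟨fun t ht => ⟨(h1 t).differentiableAt, ?_, ?_⟩, h3, ?_, ?_⟩
    · rw [hd]
      exact (h2 t).differentiableAt
    · obtain ⟨hx, hLx⟩ := exists_hodgeLaplacian_eq_of_mem_graph (h5 t)
      refine ⟨hx, ?_⟩
      rw [hLx, besselAccelZero, hd, (h2 t).deriv]
      have h7 : t⁻¹ • (t • w₂ t + ((q : ℝ) - 1) • w₁ t + t • z t) = 0 := by
        rw [h6 t, smul_zero]
      rw [← h7]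
      match_scalars <;> field_simp
    · exact (h1 0).congr_deriv h4
    · rw [hd]
      have h := (h2 0).continuousAt.tendsto
      rw [h4] at h
      exact h.mono_left nhdsWithin_le_nhds
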